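/- For a positive integer $k$, let $Z_k$ be the unique weakly holomorphic modular function on $\mathrm{SL}_2(\mathbb{Z})$ (that is, the unique $\mathrm{SL}_2(\mathbb{Z})$-invariant holomorphic function on the upper half-plane that is meromorphic at the cusp $i\infty$) whose Fourier expansion in $q=e^{2\pi i\tau}$ satisfies $$Z_k=\sum_{n\ge -k} w_k(n)q^n = q^{-k}\prod_{n\ge 2}\frac{1}{1-q^n}+O(q),$$ i.e. the coefficients of $q^n$ on both sides agree for all $n\le 0$; put $w_k(n)=0$ for $n<-k$. **Theorem 3.** Let $p\le 11$ be a prime and let $k\in\{1,\dots,p-1\}\cup\{p+1\}$. Then $Z_k$ exists and is unique, its coefficients $w_k(n)$ are integers, and for every non-zero integer $n$ $$w_k(pn)\equiv 0\begin{cases}\pmod{2^{11}} & \text{if } p=2,\\ \pmod{3^5} & \text{if } p=3,\\ \pmod{5^2} & \text{if } p=5,\\ \pmod{p} & \text{if } p=7,11.\end{cases}$$ -/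

import Mathlib

open scoped UpperHalfPlane MatrixGroups Manifold PowerSeries

noncomputable section

namespace ExtremalCFT

/-- `f(τ) = ∑_{n ∈ ℤ} a(n) qⁿ` for all `τ` in the upper half-plane, where `q = e^{2πiτ}`, with only
finitely many non-zero coefficients of negative index. -/
def HasLaurentQExpansion (f : ℍ → ℂ) (a : ℤ → ℂ) : Prop :=
  (∃ N : ℤ, ∀ n < N, a n = 0) ∧
    ∀ τ : ℍ, HasSum (fun n : ℤ => a n * Function.Periodic.qParam 1 (τ : ℂ) ^ n) (f τ)

/-- Weakly holomorphic modular functions (weight `0`) on `SL₂(ℤ)`: holomorphic on the upper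
half-plane, invariant under `SL₂(ℤ)`, and meromorphic at the cusp `i∞`. -/
structure IsWeaklyHolomorphicModularFunction (f : ℍ → ℂ) : Prop where
  holomorphic : MDifferentiable 𝓘(ℂ) 𝓘(ℂ) f
  invariant : ∀ (γ : SL(2, ℤ)) (τ : ℍ), f (γ • τ) = f τ
  meromorphic_at_cusp : ∃ a : ℤ → ℂ, HasLaurentQExpansion f a

open scoped PowerSeries.WithPiTopology in
/-- The formal power series `∏_{n ≥ 2} 1 / (1 - qⁿ)`. -/
def vacuumProduct : ℂ⟦X⟧ :=
  ∏' n : ℕ, ((1 : ℂ⟦X⟧) - PowerSeries.X ^ (n + 2))⁻¹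

open scoped PowerSeries.WithPiTopology in
/-- The infinite product defining `vacuumProduct` converges. -/
theorem multipliable_vacuumProduct :
    Multipliable fun n : ℕ => ((1 : ℂ⟦X⟧) - PowerSeries.X ^ (n + 2))⁻¹ := by
  have h : (fun n : ℕ => ((1 : ℂ⟦X⟧) - PowerSeries.X ^ (n + 2))⁻¹) =
      fun n : ℕ => 1 + PowerSeries.X ^ (n + 2) * ((1 : ℂ⟦X⟧) - PowerSeries.X ^ (n + 2))⁻¹ := by
    funext n
    have h0 : PowerSeries.constantCoeff ((1 : ℂ⟦X⟧) - PowerSeries.X ^ (n + 2)) ≠ 0 := by simp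
    have h1 := PowerSeries.mul_inv_cancel _ h0
    linear_combination h1
  rw [h]
  apply PowerSeries.WithPiTopology.multipliable_one_add_of_tendsto_order_atTop_nhds_top
  refine ENat.tendsto_nhds_top_iff_natCast_lt.mpr fun m => ?_
  filter_upwards [Filter.eventually_ge_atTop m] with n hn
  refine lt_of_lt_of_le ?_ (PowerSeries.le_order_mul _ _)
  rw [PowerSeries.order_X_pow]
  exact lt_of_lt_of_le (by exact_mod_cast (by omega : m < n + 2)) le_self_add

/-- The formal Laurent series `q^{-k} ∏_{n ≥ 2} 1 / (1 - qⁿ)`. -/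
def vacuumCharacter (k : ℕ) : LaurentSeries ℂ :=
  HahnSeries.single (-(k : ℤ)) 1 * HahnSeries.ofPowerSeries ℤ ℂ vacuumProduct

/-- `Z` is a weakly holomorphic modular function on `SL₂(ℤ)` with
`Z = q^{-k} ∏_{n ≥ 2} 1 / (1 - qⁿ) + O(q)`, that is, the coefficients of `qⁿ` on both sides agree for
all `n ≤ 0`. -/
structure IsExtremalPartitionFunction (k : ℕ) (Z : ℍ → ℂ) : Prop where
  modular : IsWeaklyHolomorphicModularFunction Z
  principalPart : ∃ w : ℤ → ℂ, HasLaurentQExpansion Z w ∧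
    ∀ n : ℤ, n ≤ 0 → w n = (vacuumCharacter k).coeff n

end ExtremalCFT

end

/-! The extremal function is an integral combination of `1` and modular functions `q^{-m} + O(1)`,
`1 ≤ m ≤ k`, the weight at `m` being the coefficient of `q^{k-m}` in the vacuum product. For `m`
prime to `p`, such a function arises from `j` by weight-zero Hecke operators of prime index `l ∣ m`.
As `l ≠ p`, they preserve the condition `M ∣ c(pn)` for all `n ≠ 0`, so everything reduces to that
condition for `j`. A multiple `m` of `p` never contributes: for `k < p` there is none, and for `k =
p + 1` the only one is `m = p`, whose weight is the coefficient of `q`, which vanishes because the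
product starts at `n = 2`. Uniqueness holds because a modular function without terms of exponent `≤
0` is a level-one form of weight zero vanishing at the cusp.

For `j` itself (`dvd_coeff_kleinJ`), choose an Eisenstein series or a power of one, `ε ≡ 1 (mod M)`,
of weight `w` with `M ∣ p^{w-1}`. The normalised Hecke operator `T_p` sends `jε` to a form with
coefficients `a(pn) + p^{w-1} a(n/p) ≡ c(pn)`, so modulo `M` its pole disappears. After subtracting
`c(0) ε`, a Sturm bound for congruences (`castSeries_eq_zero_of_X_pow_dvd`, extended to forms with
poles by multiplying by a power of `Δ`) leaves only `1 ≤ n ≤ w/12` to check. For `p = 7, 11` this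
range is empty; for `p = 2, 3, 5` it is settled by computing `qj` modulo `2¹¹ 3⁵ 5²` to 86 terms. -/

noncomputable section

namespace ExtremalCFT

open ModularForm UpperHalfPlane

/-! ### Convergent `q`-series and Laurent `q`-expansions -/

/-- The nome `q = e^{2πiτ}`. -/
abbrev nome (τ : ℍ) : ℂ := Function.Periodic.qParam 1 (τ : ℂ)

lemma nome_ne_zero (τ : ℍ) : nome τ ≠ 0 := Function.Periodic.qParam_ne_zero _

/-- `F(τ) = ∑_{n ≥ 0} Pₙ qⁿ` on the upper half-plane. -/
def HasQSeries (F : ℍ → ℂ) (P : ℂ⟦X⟧) : Prop :=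
  ∀ τ : ℍ, HasSum (fun n : ℕ => PowerSeries.coeff n P * nome τ ^ n) (F τ)

namespace HasQSeries

variable {F G : ℍ → ℂ} {P Q : ℂ⟦X⟧}

lemma add (hF : HasQSeries F P) (hG : HasQSeries G Q) : HasQSeries (F + G) (P + Q) := by
  intro τ
  simpa [add_mul] using (hF τ).add (hG τ)

lemma const_mul (hF : HasQSeries F P) (c : ℂ) : HasQSeries (c • F) (c • P) := by
  intro τ
  simpa [mul_assoc] using (hF τ).mul_left c

lemma sub (hF : HasQSeries F P) (hG : HasQSeries G Q) : HasQSeries (F - G) (P - Q) := by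
  intro τ
  simpa [sub_mul] using (hF τ).sub (hG τ)

lemma mul (hF : HasQSeries F P) (hG : HasQSeries G Q) : HasQSeries (F * G) (P * Q) := by
  intro τ
  have h1 := (hF τ).summable.norm
  have h2 := (hG τ).summable.norm
  have h3 : ∀ n : ℕ, ∑ kl ∈ Finset.HasAntidiagonal.antidiagonal n, (PowerSeries.coeff kl.1 P * nome τ ^ kl.1) *
      (PowerSeries.coeff kl.2 Q * nome τ ^ kl.2) = PowerSeries.coeff n (P * Q) * nome τ ^ n := by
    intro n
    rw [PowerSeries.coeff_mul, Finset.sum_mul]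
    refine Finset.sum_congr rfl fun kl hkl => ?_
    rw [← Finset.HasAntidiagonal.mem_antidiagonal.mp hkl, pow_add]
    ring
  have h4 := tsum_mul_tsum_eq_tsum_sum_antidiagonal_of_summable_norm h1 h2
  have h5 := (summable_norm_sum_mul_antidiagonal_of_summable_norm h1 h2).of_norm
  simp_rw [h3] at h4 h5
  rw [(hF τ).tsum_eq, (hG τ).tsum_eq] at h4
  rw [Pi.mul_apply, h4]
  exact h5.hasSum

lemma one : HasQSeries 1 1 := by
  intro τ
  refine (hasSum_ite_eq (0 : ℕ) (1 : ℂ)).congr_fun fun n => ?_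
  by_cases h : n = 0 <;> simp [PowerSeries.coeff_one, h]

lemma pow (hF : HasQSeries F P) (n : ℕ) : HasQSeries (F ^ n) (P ^ n) := by
  induction n with
  | zero => simpa using one
  | succ n ih => simpa [pow_succ] using ih.mul hF

/-- The zero function is a modular form of weight zero, so uniqueness of `q`-expansions of modular
forms applies; by linearity this gives uniqueness for arbitrary functions. -/
lemma eq_zero (h : HasQSeries 0 P) : P = 0 := by
  ext n
  have := ModularFormClass.qExpansion_coeff_unique (f := (0 : ModularForm 𝒮ℒ 0)) one_pos
    one_mem_strictPeriods_SL (c := fun n => PowerSeries.coeff n P) (by simpa [HasQSeries] using h) n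
  simpa [UpperHalfPlane.qExpansion_zero] using this

lemma unique (h : HasQSeries F P) (h' : HasQSeries F Q) : P = Q :=
  sub_eq_zero.mp (eq_zero (by simpa using h.sub h'))

lemma of_modularForm {w : ℤ} (g : ModularForm 𝒮ℒ w) : HasQSeries g (qExpansion 1 g) := by
  have : Fact (IsCusp OnePoint.infty 𝒮ℒ) :=
    ⟨Subgroup.isCusp_of_mem_strictPeriods one_pos one_mem_strictPeriods_SL⟩
  intro τ
  exact ModularForm.hasSum_qExpansion g one_pos one_mem_strictPeriods_SL τ

/-- Cancelling a factor `q`. -/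
lemma of_nome_mul (h : HasQSeries (nome * F) (PowerSeries.X * P)) : HasQSeries F P := by
  intro τ
  have h1 := (hasSum_nat_add_iff' 1).mpr (h τ)
  have h2 := h1.mul_left (nome τ)⁻¹
  simp only [Finset.range_one, Finset.sum_singleton, PowerSeries.coeff_zero_X_mul, zero_mul,
    sub_zero, Pi.mul_apply, inv_mul_cancel_left₀ (nome_ne_zero τ), PowerSeries.coeff_succ_X_mul]
    at h2
  refine h2.congr_fun fun n => ?_
  rw [pow_succ]
  field_simp [nome_ne_zero τ]

end HasQSeries

/-- The power series `∑ a(m - N) X^m`. -/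
def shiftedSeries {R : Type*} (N : ℕ) (a : ℤ → R) : R⟦X⟧ := PowerSeries.mk fun m => a ((m : ℤ) - N)

/-- Multiplication by `q^N` clears the pole, so products and uniqueness of Laurent expansions reduce
to power series. -/
lemma hasLaurentQExpansion_iff {f : ℍ → ℂ} {a : ℤ → ℂ} {N : ℕ} (ha : ∀ n < -(N : ℤ), a n = 0) :
    HasLaurentQExpansion f a ↔ HasQSeries (nome ^ N * f) (shiftedSeries N a) := by
  have key : ∀ τ : ℍ, HasSum (fun n : ℤ => a n * nome τ ^ n) (f τ) ↔
      HasSum (fun m : ℕ => PowerSeries.coeff m (shiftedSeries N a) * nome τ ^ m)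
        ((nome ^ N * f) τ) := by
    intro τ
    have hinj : Function.Injective fun m : ℕ => (m : ℤ) - N := by
      intro x y h
      simpa using h
    rw [← hinj.hasSum_iff]
    · rw [← hasSum_mul_left_iff (pow_ne_zero N (nome_ne_zero τ))]
      simp only [Function.comp_def, Pi.mul_apply, Pi.pow_apply]
      refine iff_of_eq (congrArg (fun g => HasSum g _) ?_)
      ext m
      rw [shiftedSeries, PowerSeries.coeff_mk, zpow_sub₀ (nome_ne_zero τ)]
      have := nome_ne_zero τ
      simp only [zpow_natCast]
      field_simp
    · intro n hn
      rw [ha n, zero_mul]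
      by_contra! h
      exact hn ⟨(n + N).toNat, by simp; omega⟩
  constructor
  · intro h τ
    exact (key τ).mp (h.2 τ)
  · intro h
    exact ⟨⟨_, ha⟩, fun τ => (key τ).mpr (h τ)⟩

lemma HasLaurentQExpansion.exists_bound {f : ℍ → ℂ} {a : ℤ → ℂ} (h : HasLaurentQExpansion f a) :
    ∃ N : ℕ, ∀ n < -(N : ℤ), a n = 0 := by
  obtain ⟨N, hN⟩ := h.1
  exact ⟨N.natAbs, fun n hn => hN n (by omega)⟩

lemma HasLaurentQExpansion.add {f g : ℍ → ℂ} {a b : ℤ → ℂ} (hf : HasLaurentQExpansion f a)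
    (hg : HasLaurentQExpansion g b) : HasLaurentQExpansion (f + g) (a + b) := by
  obtain ⟨⟨N, hN⟩, h1⟩ := hf
  obtain ⟨⟨M, hM⟩, h2⟩ := hg
  refine ⟨⟨min N M, fun n hn => ?_⟩, fun τ => ?_⟩
  · simp [hN n (by omega), hM n (by omega)]
  · simpa [add_mul] using (h1 τ).add (h2 τ)

lemma HasLaurentQExpansion.smul {f : ℍ → ℂ} {a : ℤ → ℂ} (hf : HasLaurentQExpansion f a) (c : ℂ) :
    HasLaurentQExpansion (c • f) (c • a) := by
  obtain ⟨⟨N, hN⟩, h1⟩ := hf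
  refine ⟨⟨N, fun n hn => ?_⟩, fun τ => ?_⟩
  · simp [hN n hn]
  · simpa [mul_assoc] using (h1 τ).mul_left c

lemma HasLaurentQExpansion.unique {f : ℍ → ℂ} {a b : ℤ → ℂ} (ha : HasLaurentQExpansion f a)
    (hb : HasLaurentQExpansion f b) : a = b := by
  obtain ⟨N, hN⟩ := ha.exists_bound
  obtain ⟨M, hM⟩ := hb.exists_bound
  have h1 := (hasLaurentQExpansion_iff (N := N + M) fun n hn => hN n (by push_cast at hn; omega)).mp ha
  have h2 := (hasLaurentQExpansion_iff (N := N + M) fun n hn => hM n (by push_cast at hn; omega)).mp hb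
  have h3 := h1.unique h2
  ext n
  by_cases hn : n < -((N + M : ℕ) : ℤ)
  · rw [hN n (by push_cast at hn; omega), hM n (by push_cast at hn; omega)]
  · have := congrArg (PowerSeries.coeff (n + (N + M : ℕ)).toNat) h3
    simp only [shiftedSeries, PowerSeries.coeff_mk] at this
    rwa [Int.toNat_of_nonneg (by omega), add_sub_cancel_right] at this

/-! ### Weakly holomorphic forms of arbitrary weight -/

/-- Weakly holomorphic modular forms of weight `w` for `SL₂(ℤ)` with Fourier coefficients `a`. -/
structure IsWeakForm (w : ℤ) (f : ℍ → ℂ) (a : ℤ → ℂ) : Prop where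
  holomorphic : MDifferentiable 𝓘(ℂ) 𝓘(ℂ) f
  slash : ∀ γ : SL(2, ℤ), f ∣[w] γ = f
  expansion : HasLaurentQExpansion f a

namespace IsWeakForm

variable {w : ℤ} {f g : ℍ → ℂ} {a b : ℤ → ℂ}

lemma add (hf : IsWeakForm w f a) (hg : IsWeakForm w g b) : IsWeakForm w (f + g) (a + b) where
  holomorphic := hf.holomorphic.add hg.holomorphic
  slash γ := by rw [SlashAction.add_slash, hf.slash, hg.slash]
  expansion := hf.expansion.add hg.expansion

lemma smul (hf : IsWeakForm w f a) (c : ℂ) : IsWeakForm w (c • f) (c • a) where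
  holomorphic := hf.holomorphic.const_smul c
  slash γ := by rw [ModularForm.SL_smul_slash, hf.slash]
  expansion := hf.expansion.smul c

end IsWeakForm

/-- A weakly holomorphic form with no pole at the cusp is a modular form. -/
lemma exists_modularForm {w : ℤ} {f : ℍ → ℂ} {P : ℂ⟦X⟧} (hol : MDifferentiable 𝓘(ℂ) 𝓘(ℂ) f)
    (hs : ∀ γ : SL(2, ℤ), f ∣[w] γ = f) (hP : HasQSeries f P) :
    ∃ g : ModularForm 𝒮ℒ w, ⇑g = f ∧ qExpansion 1 g = P := by
  let g : ModularForm 𝒮ℒ w :=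
    { toFun := f
      slash_action_eq' := by
        rintro _ ⟨γ, rfl⟩
        exact hs γ
      holo' := hol
      bdd_at_cusps' := by
        intro c hc
        rw [Subgroup.IsArithmetic.isCusp_iff_isCusp_SL2Z] at hc
        rw [OnePoint.isBoundedAt_iff_forall_SL2Z hc]
        intro γ _
        rw [hs γ]
        exact isBoundedAtImInfty_of_hasSum_qExpansion one_pos
          (c := fun n => PowerSeries.coeff n P) (by simpa [smul_eq_mul] using! hP) }
  exact ⟨g, rfl, (HasQSeries.of_modularForm g).unique hP⟩

/-! ### Hecke operators of prime index -/

/-- The point `(mτ + b) / d`. -/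
def affinePoint (m : ℕ) [NeZero m] (b : ℤ) (d : ℕ) [NeZero d] (τ : ℍ) : ℍ :=
  ⟨(m * (τ : ℂ) + b) / d, by
    have hm : (0 : ℝ) < m := by exact_mod_cast NeZero.pos m
    have hd : (0 : ℝ) < d := by exact_mod_cast NeZero.pos d
    have : ((m * (τ : ℂ) + b) / d).im = m * τ.im / d := by
      simp [Complex.div_natCast_im]
    rw [this]
    exact div_pos (mul_pos hm τ.im_pos) hd⟩

section

variable (m : ℕ) [NeZero m] (b : ℤ) (d : ℕ) [NeZero d]

@[simp]
lemma coe_affinePoint (τ : ℍ) : (affinePoint m b d τ : ℂ) = (m * (τ : ℂ) + b) / d := rfl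

lemma mdifferentiable_comp_affinePoint {f : ℍ → ℂ} (hf : MDifferentiable 𝓘(ℂ) 𝓘(ℂ) f) :
    MDifferentiable 𝓘(ℂ) 𝓘(ℂ) fun τ => f (affinePoint m b d τ) := by
  rw [UpperHalfPlane.mdifferentiable_iff] at hf ⊢
  have h1 : DifferentiableOn ℂ (fun z : ℂ => (m * z + b) / d) {z | 0 < z.im} := by fun_prop
  have h2 : Set.MapsTo (fun z : ℂ => (m * z + b) / d) {z | 0 < z.im} {z | 0 < z.im} := by
    intro z hz
    exact (affinePoint m b d ⟨z, hz⟩).im_pos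
  refine (hf.comp h1 h2).congr fun z hz => ?_
  have h3 : 0 < ((m * z + b) / d).im := h2 hz
  simp only [Function.comp_apply, ofComplex_apply_of_im_pos hz, ofComplex_apply_of_im_pos h3]
  rfl

end

/-- The (unnormalised) Hecke operator of prime index `l` in weight `w`. -/
def heckeOperator (l : ℕ) [NeZero l] (w : ℤ) (f : ℍ → ℂ) (τ : ℍ) : ℂ :=
  (l : ℂ) ^ w * f (affinePoint l 0 1 τ) + ∑ b : ZMod l, f (affinePoint 1 (ZMod.val b) l τ)

/-- The action of the Hecke operator on Fourier coefficients. -/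
def heckeCoeff {R : Type*} [Semiring R] (l : ℕ) (u : R) (a : ℤ → R) (n : ℤ) : R :=
  l * a (l * n) + if (l : ℤ) ∣ n then u * a (n / l) else 0

section slash

variable {w : ℤ} {f : ℍ → ℂ} (hs : ∀ γ : SL(2, ℤ), f ∣[w] γ = f)
include hs

lemma apply_smul_of_slash (γ : SL(2, ℤ)) (τ : ℍ) : f (γ • τ) = denom γ τ ^ w * f τ := by
  have h := congrFun (hs γ) τ
  rw [SL_slash_apply] at h
  rw [← h, mul_comm, mul_assoc, ← zpow_add₀ (denom_ne_zero _ _)]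
  simp

lemma apply_eq_of_coe_eq (a b c d : ℤ) (hdet : a * d - b * c = 1) (τ σ : ℍ)
    (h : (σ : ℂ) * (c * τ + d) = a * τ + b) : f σ = (c * (τ : ℂ) + d) ^ w * f τ := by
  let γ : SL(2, ℤ) := ⟨!![a, b; c, d], by rw [Matrix.det_fin_two_of, hdet]⟩
  have hden : denom γ τ = c * (τ : ℂ) + d := 
    (ModularGroup.denom_apply γ τ).trans (by simp [γ])
  have hne : c * (τ : ℂ) + d ≠ 0 := hden ▸ denom_ne_zero _ _
  have : γ • τ = σ := by
    ext
    rw [specialLinearGroup_apply]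
    simp only [γ]
    simp only [Matrix.of_apply, Matrix.cons_val', Matrix.cons_val_zero, Matrix.cons_val_one,
      Matrix.cons_val_fin_one, algebraMap_int_eq, eq_intCast, Complex.ofReal_intCast]
    rw [← h, mul_div_cancel_right₀ _ hne]
  rw [← this, apply_smul_of_slash hs, hden]

lemma apply_add_int (τ σ : ℍ) (k : ℤ) (h : (σ : ℂ) = τ + k) : f σ = f τ := by
  have := apply_eq_of_coe_eq hs 1 k 0 1 (by ring) τ σ (by simp [h])
  simpa using this

lemma apply_affinePoint_congr {l : ℕ} [NeZero l] {b c : ℤ} (h : (b : ZMod l) = c) (τ : ℍ) :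
    f (affinePoint 1 b l τ) = f (affinePoint 1 c l τ) := by
  obtain ⟨k, hk⟩ := (ZMod.intCast_eq_intCast_iff_dvd_sub c b l).mp h.symm
  refine apply_add_int hs _ _ k ?_
  have hl : (l : ℂ) ≠ 0 := NeZero.ne _
  have : (b : ℂ) = c + l * k := by
    have : b = c + l * k := by omega
    exact_mod_cast this
  simp [this]
  field_simp
  ring

/-- It suffices to test the generators. `S` exchanges the terms at `lτ` and `τ/l` and permutes the
others by `b ↦ -b⁻¹`; `T` fixes the term at `lτ` and shifts `b` by one. -/
lemma heckeOperator_slash (l : ℕ) [Fact l.Prime] (γ : SL(2, ℤ)) :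
    heckeOperator l w f ∣[w] γ = heckeOperator l w f := by
  have hl : (l : ℂ) ≠ 0 := NeZero.ne _
  refine SlashInvariantForm.slash_action_generators_SL2Z ?_ ?_ γ
  · ext τ
    have hτ : (τ : ℂ) ≠ 0 := τ.ne_zero
    have hden : denom ModularGroup.S τ = τ := ModularGroup.denom_S τ
    rw [SL_slash_apply, hden, modular_S_smul]
    set σ : ℍ := ⟨(-(τ : ℂ))⁻¹, _⟩ with hσ
    have hσc : (σ : ℂ) = (-(τ : ℂ))⁻¹ := rfl
    have h1 : f (affinePoint l 0 1 σ) = ((τ : ℂ) / l) ^ w * f (affinePoint 1 ((0 : ZMod l).val : ℤ) l τ) := by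
      have := apply_eq_of_coe_eq hs 0 (-1) 1 0 (by ring) (affinePoint 1 ((0 : ZMod l).val : ℤ) l τ)
        (affinePoint l 0 1 σ) (by simp [hσc]; field_simp)
      simpa using this
    have h2 : f (affinePoint 1 ((0 : ZMod l).val : ℤ) l σ) = (l * (τ : ℂ)) ^ w * f (affinePoint l 0 1 τ) := by
      have := apply_eq_of_coe_eq hs 0 (-1) 1 0 (by ring) (affinePoint l 0 1 τ)
        (affinePoint 1 ((0 : ZMod l).val : ℤ) l σ) (by simp [hσc]; field_simp)
      simpa using this
    have h3 : ∀ b : ZMod l, b ≠ 0 → f (affinePoint 1 (b.val : ℤ) l σ) =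
        (τ : ℂ) ^ w * f (affinePoint 1 ((-b⁻¹).val : ℤ) l τ) := by
      intro b hb
      -- With `c = -b⁻¹` and `bc + 1 = lk`, the matrix `(b, -k; l, -c)` has determinant one and
      -- carries `(τ + c)/l` to `(-1/τ + b)/l`, with automorphy denominator `τ`.
      obtain ⟨k, hk⟩ : (l : ℤ) ∣ (b.val : ℤ) * ((-b⁻¹).val : ℤ) + 1 := by
        rw [← ZMod.intCast_zmod_eq_zero_iff_dvd]
        simp [hb]
      generalize -b⁻¹ = c at hk ⊢
      have hkc : (b.val : ℂ) * (c.val : ℂ) + 1 = l * k := by exact_mod_cast hk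
      have := apply_eq_of_coe_eq hs (b.val : ℤ) (-k) l (-(c.val : ℤ)) (by linarith)
        (affinePoint 1 (c.val : ℤ) l τ) (affinePoint 1 (b.val : ℤ) l σ) (by
          simp only [coe_affinePoint, hσc]
          push_cast
          field_simp
          linear_combination (-(τ : ℂ)) * hkc)
      rw [this]
      congr 2
      simp only [coe_affinePoint]
      push_cast
      field_simp
      ring
    have hsum : ∑ b ∈ Finset.univ.erase (0 : ZMod l), f (affinePoint 1 (b.val : ℤ) l σ) =
        (τ : ℂ) ^ w * ∑ b ∈ Finset.univ.erase (0 : ZMod l), f (affinePoint 1 (b.val : ℤ) l τ) := by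
      rw [Finset.mul_sum]
      refine Finset.sum_bij' (fun b _ => -b⁻¹) (fun b _ => -b⁻¹) ?_ ?_ ?_ ?_ ?_
      · simp
      · simp
      · simp [inv_neg]
      · simp [inv_neg]
      · intro b hb
        exact h3 b (Finset.ne_of_mem_erase hb)
    have split : ∀ σ : ℍ, heckeOperator l w f σ = (l : ℂ) ^ w * f (affinePoint l 0 1 σ) +
        (f (affinePoint 1 ((0 : ZMod l).val : ℤ) l σ) +
          ∑ b ∈ Finset.univ.erase (0 : ZMod l), f (affinePoint 1 (b.val : ℤ) l σ)) := by
      intro σ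
      exact congrArg _ (Finset.add_sum_erase Finset.univ
        (fun b : ZMod l => f (affinePoint 1 (b.val : ℤ) l σ)) (Finset.mem_univ 0)).symm
    rw [split, split, h1, h2, hsum, div_zpow, mul_zpow, zpow_neg]
    have := zpow_ne_zero w hτ
    have := zpow_ne_zero w hl
    field_simp
    ring
  · ext τ
    have hden : denom ModularGroup.T τ = 1 := 
      (ModularGroup.denom_apply ModularGroup.T τ).trans (by simp [ModularGroup.T])
    rw [SL_slash_apply, hden, one_zpow, mul_one]
    have hT : ((ModularGroup.T • τ : ℍ) : ℂ) = τ + 1 := by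
      rw [modular_T_smul]
      simp [add_comm]
    generalize ModularGroup.T • τ = σ at hT
    rw [heckeOperator, heckeOperator]
    congr 1
    · congr 1
      refine apply_add_int hs _ _ l ?_
      simp [hT]
      ring
    · refine Fintype.sum_equiv (Equiv.addRight 1) _ _ fun b => ?_
      have : affinePoint 1 (b.val : ℤ) l σ = affinePoint 1 ((b.val : ℤ) + 1) l τ := by
        ext
        simp [hT]
        ring
      rw [this]
      apply apply_affinePoint_congr hs
      simp

end slash

lemma mdifferentiable_heckeOperator (l : ℕ) [NeZero l] (w : ℤ) {f : ℍ → ℂ}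
    (hf : MDifferentiable 𝓘(ℂ) 𝓘(ℂ) f) : MDifferentiable 𝓘(ℂ) 𝓘(ℂ) (heckeOperator l w f) := by
  have h : heckeOperator l w f = (l : ℂ) ^ w • (fun τ => f (affinePoint l 0 1 τ)) +
      ∑ b : ZMod l, fun τ => f (affinePoint 1 (ZMod.val b) l τ) := by
    ext τ
    simp [heckeOperator]
  rw [h]
  refine ((mdifferentiable_comp_affinePoint _ _ _ hf).const_smul _).add ?_
  exact MDifferentiable.sum fun b _ => mdifferentiable_comp_affinePoint _ _ _ hf

lemma sum_zmod_root_zpow (l : ℕ) [Fact l.Prime] (n : ℤ) :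
    ∑ b : ZMod l, (Complex.exp (2 * Real.pi * Complex.I / l) ^ b.val) ^ n =
      if (l : ℤ) ∣ n then (l : ℂ) else 0 := by
  have hl := (Fact.out : l.Prime)
  set ζ := Complex.exp (2 * Real.pi * Complex.I / l)
  have hζ : IsPrimitiveRoot ζ l := Complex.isPrimitiveRoot_exp l hl.ne_zero
  have h1 : ∑ b : ZMod l, (ζ ^ b.val) ^ n = ∑ i ∈ Finset.range l, (ζ ^ n) ^ i := by
    refine Finset.sum_bij (fun b _ => b.val) ?_ ?_ ?_ ?_
    · intro b _
      exact Finset.mem_range.mpr (ZMod.val_lt b)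
    · intro b _ c _ h
      exact ZMod.val_injective l h
    · intro i hi
      exact ⟨i, Finset.mem_univ _, ZMod.val_cast_of_lt (Finset.mem_range.mp hi)⟩
    · intro b _
      rw [← zpow_natCast, ← zpow_natCast, ← zpow_mul, ← zpow_mul, mul_comm]
  rw [h1]
  split_ifs with h
  · rw [(hζ.zpow_eq_one_iff_dvd n).mpr h]
    simp
  · have h2 : ζ ^ n ≠ 1 := fun h' => h ((hζ.zpow_eq_one_iff_dvd n).mp h')
    have h3 := mul_neg_geom_sum (ζ ^ n) l
    have h4 : (ζ ^ n) ^ l = 1 := by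
      rw [← zpow_natCast, ← zpow_mul, mul_comm, zpow_mul, zpow_natCast, hζ.pow_eq_one, one_zpow]
    rw [h4, sub_self] at h3
    exact (mul_eq_zero.mp h3).resolve_left (sub_ne_zero.mpr h2.symm)

/-- Replacing `τ` by `lτ` turns `q` into `q^l`. Summing over the points `(τ + b)/l` averages over
`l`-th roots of unity, which keeps only the exponents divisible by `l` and multiplies them by `l`.
-/
lemma HasLaurentQExpansion.heckeOperator {f : ℍ → ℂ} {a : ℤ → ℂ} (hf : HasLaurentQExpansion f a)
    (l : ℕ) [Fact l.Prime] (w : ℤ) :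
    HasLaurentQExpansion (heckeOperator l w f) (heckeCoeff l ((l : ℂ) ^ w) a) := by
  have hl : 0 < l := (Fact.out : l.Prime).pos
  have hlC : (l : ℂ) ≠ 0 := NeZero.ne _
  obtain ⟨N, hN⟩ := hf.exists_bound
  refine ⟨⟨-(l * N : ℤ), fun n hn => ?_⟩, fun τ => ?_⟩
  · have h1 : a (l * n) = 0 := by
      apply hN
      have h3 : (N : ℤ) ≤ l * N := le_mul_of_one_le_left (by positivity) (by omega)
      have h4 : l * n ≤ 1 * n := mul_le_mul_of_nonpos_right (by omega) (by omega)
      omega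
    have h2 : (l : ℤ) ∣ n → a (n / l) = 0 := by
      rintro ⟨k, rfl⟩
      rw [Int.mul_ediv_cancel_left _ (by omega)]
      apply hN
      by_contra! h
      nlinarith
    simp +contextual [heckeCoeff, h1, h2]
  · have hinj : Function.Injective fun n : ℤ => (l : ℤ) * n :=
      mul_right_injective₀ (by omega)
    have hA : HasSum (fun n : ℤ => (if (l : ℤ) ∣ n then (l : ℂ) ^ w * a (n / l) else 0) * nome τ ^ n)
        ((l : ℂ) ^ w * f (affinePoint l 0 1 τ)) := by
      rw [← hinj.hasSum_iff]
      · refine ((hf.2 (affinePoint l 0 1 τ)).mul_left ((l : ℂ) ^ w)).congr_fun fun n => ?_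
        have : Function.Periodic.qParam 1 (affinePoint l 0 1 τ : ℂ) = nome τ ^ l := by
          simp only [nome, Function.Periodic.qParam]
          rw [← Complex.exp_nat_mul]
          congr 1
          simp
          ring
        rw [this, ← zpow_natCast, ← zpow_mul]
        simp only [Function.comp_apply, dvd_mul_right, if_true]
        rw [Int.mul_ediv_cancel_left _ (by omega), mul_assoc]
      · intro n hn
        rw [if_neg, zero_mul]
        rintro ⟨k, rfl⟩
        exact hn ⟨k, rfl⟩
    have hB : HasSum (fun n : ℤ => (l * a (l * n)) * nome τ ^ n)
        (∑ b : ZMod l, f (affinePoint 1 (ZMod.val b) l τ)) := by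
      -- `x` is the root `q^{1/l}` determined by `τ`.
      set x := Complex.exp (2 * Real.pi * Complex.I * τ / l) with hx
      have hxl : x ^ l = nome τ := by
        simp only [nome, hx, Function.Periodic.qParam]
        rw [← Complex.exp_nat_mul]
        congr 1
        field_simp
        simp
      have h1 : HasSum (fun n : ℤ => ∑ b : ZMod l, a n * nome (affinePoint 1 (ZMod.val b) l τ) ^ n)
          (∑ b : ZMod l, f (affinePoint 1 (ZMod.val b) l τ)) :=
        hasSum_sum fun b _ => hf.2 _
      have h2 : ∀ b : ZMod l, nome (affinePoint 1 (ZMod.val b) l τ) =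
          Complex.exp (2 * Real.pi * Complex.I / l) ^ b.val * x := by
        intro b
        simp only [nome, hx, Function.Periodic.qParam]
        rw [← Complex.exp_nat_mul, ← Complex.exp_add]
        congr 1
        simp
        ring
      have h3 : ∀ n : ℤ, ∑ b : ZMod l, a n * nome (affinePoint 1 (ZMod.val b) l τ) ^ n =
          a n * x ^ n * if (l : ℤ) ∣ n then (l : ℂ) else 0 := by
        intro n
        rw [← sum_zmod_root_zpow l n, Finset.mul_sum]
        refine Finset.sum_congr rfl fun b _ => ?_
        rw [h2, mul_zpow]
        ring
      simp_rw [h3] at h1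
      rw [← hinj.hasSum_iff] at h1
      · refine h1.congr_fun fun n => ?_
        simp only [Function.comp_apply, dvd_mul_right, if_true]
        rw [zpow_mul, zpow_natCast, hxl]
        ring
      · intro n hn
        rw [if_neg, mul_zero]
        rintro ⟨k, rfl⟩
        exact hn ⟨k, rfl⟩
    rw [ExtremalCFT.heckeOperator, add_comm]
    refine (hB.add hA).congr_fun fun n => ?_
    rw [heckeCoeff, add_mul]

lemma IsWeakForm.heckeOperator {w : ℤ} {f : ℍ → ℂ} {a : ℤ → ℂ} (hf : IsWeakForm w f a)
    (l : ℕ) [Fact l.Prime] :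
    IsWeakForm w (heckeOperator l w f) (heckeCoeff l ((l : ℂ) ^ w) a) where
  holomorphic := mdifferentiable_heckeOperator l w hf.holomorphic
  slash := heckeOperator_slash hf.slash l
  expansion := hf.expansion.heckeOperator l w

/-! ### Integral `q`-expansions of `E₄`, `E₆`, `Δ` and `1/Δ` -/

/-- Reduction of the coefficients of an integral power series to a ring. -/
abbrev castSeries (R : Type*) [CommRing R] : ℤ⟦X⟧ →+* R⟦X⟧ := PowerSeries.map (Int.castRingHom R)

lemma castSeries_complex_injective : Function.Injective (castSeries ℂ) :=
  PowerSeries.map_injective _ Int.cast_injective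

/-- `∑ σₖ(n) Xⁿ`. -/
def sigmaSeries (k : ℕ) : ℤ⟦X⟧ := PowerSeries.mk fun n => (ArithmeticFunction.sigma k n : ℤ)

/-- The `q`-expansion of `E₄`. -/
def eisensteinFour : ℤ⟦X⟧ := 1 + 240 * sigmaSeries 3

/-- The `q`-expansion of `E₆`. -/
def eisensteinSix : ℤ⟦X⟧ := 1 - 504 * sigmaSeries 5

lemma qExpansion_E_of_coeff {k : ℕ} (hk : 3 ≤ k) (hk2 : Even k) (u : ℤ)
    (hu : -(2 * (k : ℂ) / (bernoulli k : ℂ)) = u) :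
    qExpansion 1 (E hk) = castSeries ℂ (1 + (u : ℤ⟦X⟧) * sigmaSeries (k - 1)) := by
  ext n
  rw [EisensteinSeries.E_qExpansion_coeff hk hk2, hu]
  have h1 : (u : ℤ⟦X⟧) = PowerSeries.C u := by simp
  rw [h1, PowerSeries.coeff_map, map_add, PowerSeries.coeff_C_mul, sigmaSeries,
    PowerSeries.coeff_mk, PowerSeries.coeff_one]
  by_cases h : n = 0 <;> simp [h]

lemma qExpansion_E₄ : qExpansion 1 E₄ = castSeries ℂ eisensteinFour := by
  rw [E₄, qExpansion_E_of_coeff _ ⟨2, rfl⟩ 240]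
  · simp [eisensteinFour]
  · norm_num [show bernoulli 4 = -1 / 30 by decide +kernel]

lemma qExpansion_E₆ : qExpansion 1 E₆ = castSeries ℂ eisensteinSix := by
  rw [E₆, qExpansion_E_of_coeff _ ⟨3, rfl⟩ (-504)]
  · simp [eisensteinSix, sub_eq_add_neg]
  · norm_num [show bernoulli 6 = 1 / 42 by decide +kernel]

/-- Holds divisor by divisor, since `5d³ + 7d⁵ ≡ 0 (mod 12)`. It makes `(E₄³ - E₆²)/1728` integral:
the linear part is `144 (5σ₃ + 7σ₅)`, and the higher terms are visibly divisible by 1728. -/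
lemma twelve_dvd_sigma (n : ℕ) :
    (12 : ℤ) ∣ 5 * (ArithmeticFunction.sigma 3 n : ℤ) + 7 * (ArithmeticFunction.sigma 5 n : ℤ) := by
  simp only [ArithmeticFunction.sigma_apply, Nat.cast_sum, Nat.cast_pow, Finset.mul_sum]
  rw [← Finset.sum_add_distrib]
  refine Finset.dvd_sum fun d _ => ?_
  have h : ∀ x : ZMod 12, 5 * x ^ 3 + 7 * x ^ 5 = 0 := by decide
  have := h d
  exact (ZMod.intCast_zmod_eq_zero_iff_dvd _ 12).mp (by push_cast; exact this)

/-- The linear term of `(E₄³ - E₆²) / 1728`. -/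
def discriminantLinear : ℤ⟦X⟧ := PowerSeries.mk fun n =>
  (5 * (ArithmeticFunction.sigma 3 n : ℤ) + 7 * (ArithmeticFunction.sigma 5 n : ℤ)) / 12

lemma twelve_mul_discriminantLinear :
    12 * discriminantLinear = 5 * sigmaSeries 3 + 7 * sigmaSeries 5 := by
  ext n
  have h1 : (12 : ℤ⟦X⟧) = PowerSeries.C 12 := by simp
  have h2 : (5 : ℤ⟦X⟧) = PowerSeries.C 5 := by simp
  have h3 : (7 : ℤ⟦X⟧) = PowerSeries.C 7 := by simp
  rw [h1, h2, h3]
  simp only [PowerSeries.coeff_C_mul, map_add, discriminantLinear, sigmaSeries,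
    PowerSeries.coeff_mk]
  exact Int.mul_ediv_cancel' (twelve_dvd_sigma n)

/-- The `q`-expansion of the discriminant, in terms of divisor sums. -/
def discriminantSeries : ℤ⟦X⟧ := discriminantLinear + 100 * sigmaSeries 3 ^ 2 +
  8000 * sigmaSeries 3 ^ 3 - 147 * sigmaSeries 5 ^ 2

lemma discriminantSeries_spec :
    1728 * discriminantSeries = eisensteinFour ^ 3 - eisensteinSix ^ 2 := by
  rw [discriminantSeries, eisensteinFour, eisensteinSix]
  linear_combination 144 * twelve_mul_discriminantLinear

lemma hasQSeries_E₄ : HasQSeries E₄ (castSeries ℂ eisensteinFour) :=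
  qExpansion_E₄ ▸ HasQSeries.of_modularForm E₄

lemma hasQSeries_E₆ : HasQSeries E₆ (castSeries ℂ eisensteinSix) :=
  qExpansion_E₆ ▸ HasQSeries.of_modularForm E₆

lemma hasQSeries_discriminant :
    HasQSeries discriminant (castSeries ℂ discriminantSeries) := by
  have h := ((hasQSeries_E₄.pow 3).sub (hasQSeries_E₆.pow 2)).const_mul (1 / 1728)
  have h1 : (1 / 1728 : ℂ) • ((⇑E₄) ^ 3 - (⇑E₆) ^ 2) = discriminant := by
    ext τ
    rw [discriminant_eq_E₄_cube_sub_E₆_sq]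
    simp
    ring
  have h2 : (1 / 1728 : ℂ) • (castSeries ℂ eisensteinFour ^ 3 - castSeries ℂ eisensteinSix ^ 2) =
      castSeries ℂ discriminantSeries := by
    rw [← map_pow, ← map_pow, ← map_sub, ← discriminantSeries_spec, map_mul, map_ofNat,
      PowerSeries.smul_eq_C_mul, ← mul_assoc]
    have : PowerSeries.C (1 / 1728 : ℂ) * 1728 = 1 := by
      have h3 : (1728 : ℂ⟦X⟧) = PowerSeries.C 1728 := (map_ofNat PowerSeries.C 1728).symm
      rw [h3, ← map_mul]
      norm_num
    rw [this, one_mul]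
  rwa [h1, h2] at h

lemma qExpansion_discriminant : qExpansion 1 discriminant = castSeries ℂ discriminantSeries :=
  (HasQSeries.of_modularForm
    (⟨CuspForm.discriminant.toSlashInvariantForm, CuspForm.discriminant.holo',
      ModularFormClass.bdd_at_cusps CuspForm.discriminant⟩ : ModularForm 𝒮ℒ 12)).unique
    hasQSeries_discriminant

/-- The power series `Δ / q`. -/
def discriminantUnit : ℤ⟦X⟧ := PowerSeries.mk fun n => PowerSeries.coeff (n + 1) discriminantSeries

lemma coeff_discriminantSeries_zero : PowerSeries.coeff 0 discriminantSeries = 0 := by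
  have h : PowerSeries.coeff 0 (castSeries ℂ discriminantSeries) = 0 := by
    rw [← qExpansion_discriminant]
    exact PowerSeries.coeff_of_lt_order _ (by rw [discriminant_qExpansion_order]; simp)
  simpa using h

lemma X_mul_discriminantUnit : PowerSeries.X * discriminantUnit = discriminantSeries := by
  ext n
  cases n with
  | zero => rw [PowerSeries.coeff_zero_X_mul, coeff_discriminantSeries_zero]
  | succ n => rw [PowerSeries.coeff_succ_X_mul, discriminantUnit, PowerSeries.coeff_mk]

lemma constantCoeff_discriminantUnit : PowerSeries.constantCoeff discriminantUnit = 1 := by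
  have h := discriminant_qExpansion_coeff_one
  rw [qExpansion_discriminant] at h
  rw [← PowerSeries.coeff_zero_eq_constantCoeff_apply, discriminantUnit, PowerSeries.coeff_mk]
  simpa using h

/-- The power series `q / Δ`. -/
def discriminantInv : ℤ⟦X⟧ := PowerSeries.invOfUnit discriminantUnit 1

lemma discriminantUnit_mul_inv : discriminantUnit * discriminantInv = 1 :=
  PowerSeries.mul_invOfUnit _ _ (by simp [constantCoeff_discriminantUnit])

lemma hasQSeries_discriminant_div :
    HasQSeries (discriminant / nome) (castSeries ℂ discriminantUnit) := by
  apply HasQSeries.of_nome_mul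
  have h1 : nome * (discriminant / nome) = discriminant := by
    ext τ
    exact mul_div_cancel₀ _ (nome_ne_zero τ)
  rw [h1, show (PowerSeries.X : ℂ⟦X⟧) = castSeries ℂ PowerSeries.X by simp, ← map_mul,
    X_mul_discriminantUnit]
  exact hasQSeries_discriminant

lemma mdifferentiable_nome : MDifferentiable 𝓘(ℂ) 𝓘(ℂ) nome := by
  rw [UpperHalfPlane.mdifferentiable_iff]
  have h : DifferentiableOn ℂ (fun z : ℂ => Function.Periodic.qParam 1 z) {z | 0 < z.im} := by
    simp only [Function.Periodic.qParam]
    fun_prop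
  refine h.congr fun z hz => ?_
  simp [Function.comp_apply, ofComplex_apply_of_im_pos hz]

/-- The formal inverse of `Δ/q` need not converge a priori. Convergence comes from analysis: `q/Δ`
is periodic, holomorphic and bounded at the cusp, hence has some `q`-expansion, and its product with
that of `Δ/q` is `1`. -/
lemma hasQSeries_nome_div : HasQSeries (nome / discriminant) (castSeries ℂ discriminantInv) := by
  have hper : Function.Periodic ((nome / discriminant) ∘ ofComplex) (1 : ℝ) := by
    intro z
    have h1 : discriminant (ofComplex (z + (1 : ℝ))) = discriminant (ofComplex z) :=
      SlashInvariantFormClass.periodic_comp_ofComplex (h := 1) CuspForm.discriminant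
        one_mem_strictPeriods_SL z
    have h2 : nome (ofComplex (z + (1 : ℝ))) = nome (ofComplex z) := by
      by_cases hz : 0 < z.im
      · have hz' : 0 < (z + (1 : ℝ)).im := by simpa using hz
        simp only [nome, ofComplex_apply_of_im_pos hz, ofComplex_apply_of_im_pos hz']
        simp [Function.Periodic.qParam, mul_add, Complex.exp_add]
      · have hz' : (z + (1 : ℝ)).im ≤ 0 := by simpa using hz
        rw [ofComplex_apply_of_im_nonpos hz', ofComplex_apply_of_im_nonpos (not_lt.mp hz)]
    rw [Function.comp_apply, Function.comp_apply, Pi.div_apply, Pi.div_apply, h1, h2]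
  have hol : MDifferentiable 𝓘(ℂ) 𝓘(ℂ) (nome / discriminant) :=
    mdifferentiable_nome.div CuspForm.discriminant.holo' discriminant_ne_zero
  have hbdd : IsBoundedAtImInfty (nome / discriminant) := by
    have h1 : (fun τ : ℍ => nome τ) =O[atImInfty] discriminant := by
      refine (Asymptotics.IsBigO.of_bound 1 ?_).trans exp_isBigO_discriminant
      filter_upwards with τ
      rw [Function.Periodic.norm_qParam]
      simp
    exact (Asymptotics.div_isBoundedUnder_of_isBigO h1).isBigO_one ℝ
  have h : HasQSeries (nome / discriminant) (qExpansion 1 (nome / discriminant)) := fun τ => by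
    simpa using UpperHalfPlane.hasSum_qExpansion one_pos hper hol hbdd τ
  have h1 : (discriminant / nome) * (nome / discriminant) = 1 := by
    ext τ
    have := nome_ne_zero τ
    have := discriminant_ne_zero τ
    simp only [Pi.mul_apply, Pi.div_apply, Pi.one_apply]
    field_simp
  have h2 := (h1 ▸ hasQSeries_discriminant_div.mul h).unique HasQSeries.one
  have h3 : castSeries ℂ discriminantUnit * castSeries ℂ discriminantInv = 1 := by
    rw [← map_mul, discriminantUnit_mul_inv, map_one]
  have h4 : qExpansion 1 (nome / discriminant) = castSeries ℂ discriminantInv := by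
    calc _ = (castSeries ℂ discriminantUnit * qExpansion 1 (nome / discriminant)) *
          castSeries ℂ discriminantInv := by linear_combination (-qExpansion 1 (nome / discriminant)) * h3
      _ = _ := by rw [h2, one_mul]
  rwa [h4] at h

/-! ### The Sturm bound over an arbitrary coefficient ring -/

lemma exists_eisenstein_monomial (a b : ℕ) : ∃ e : ModularForm 𝒮ℒ (4 * a + 6 * b : ℤ),
    qExpansion 1 e = castSeries ℂ (eisensteinFour ^ a * eisensteinSix ^ b) := by
  refine ⟨ModularForm.mcast (by ring) ((E₄.pow a).mul (E₆.pow b)), ?_⟩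
  rw [ModularForm.qExpansion_mcast (by ring) rfl, ModularForm.qExpansion_mul one_pos one_mem_strictPeriods_SL,
    ModularForm.qExpansion_pow one_pos one_mem_strictPeriods_SL,
    ModularForm.qExpansion_pow one_pos one_mem_strictPeriods_SL, qExpansion_E₄, qExpansion_E₆]
  simp

lemma constantCoeff_eisenstein_monomial (a b : ℕ) :
    PowerSeries.coeff 0 (eisensteinFour ^ a * eisensteinSix ^ b) = 1 := by
  simp [eisensteinFour, eisensteinSix, sigmaSeries]

lemma exists_four_mul_add_six_mul {w : ℕ} (hw : Even w) (hw2 : w ≠ 2) : ∃ a b, w = 4 * a + 6 * b := by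
  obtain ⟨r, rfl⟩ := hw
  rcases Nat.even_or_odd' r with ⟨s, rfl | rfl⟩
  · exact ⟨s, 0, by ring⟩
  · exact ⟨s - 1, 1, by omega⟩

/-- A Sturm bound for congruences between integral modular forms of level one. -/
theorem castSeries_eq_zero_of_X_pow_dvd (R : Type*) [CommRing R] (w : ℕ) (g : ModularForm 𝒮ℒ w)
    (G : ℤ⟦X⟧) (hG : qExpansion 1 g = castSeries ℂ G)
    (h : PowerSeries.X ^ (w / 12 + 1) ∣ castSeries R G) : castSeries R G = 0 := by
  induction w using Nat.strong_induction_on generalizing G with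
  | _ w ih =>
  have of_zero : g = 0 → castSeries R G = 0 := by
    rintro rfl
    have : G = 0 := castSeries_complex_injective (by
      rw [← hG, map_zero]
      exact UpperHalfPlane.qExpansion_zero 1)
    rw [this, map_zero]
  by_cases hodd : Odd w
  · exact of_zero (ModularForm.levelOne_odd_weight_eq_zero (by exact_mod_cast hodd) g)
  by_cases hw2 : w = 2
  · subst hw2
    exact of_zero (rank_zero_iff_forall_zero.mp levelOne_weight_two_rank_zero g)
  obtain ⟨a, b, hab⟩ := exists_four_mul_add_six_mul (Nat.not_odd_iff_even.mp hodd) hw2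
  obtain ⟨e, he⟩ := exists_eisenstein_monomial a b
  have hε0 := constantCoeff_eisenstein_monomial a b
  generalize eisensteinFour ^ a * eisensteinSix ^ b = ε at he hε0
  let e' : ModularForm 𝒮ℒ w := ModularForm.mcast (by rw [hab]; push_cast; ring) e
  have he' : qExpansion 1 e' = castSeries ℂ ε := he
  set c := PowerSeries.coeff 0 G with hc
  -- Removing the constant term with an integral Eisenstein monomial leaves a cusp form; dividing it
  -- by `Δ` lowers the weight by 12 and keeps the expansion integral, as `Δ/q` has an integral
  -- inverse.
  obtain ⟨d, hd⟩ : ∃ d : ModularForm 𝒮ℒ w, d = g - (c : ℂ) • e' := ⟨_, rfl⟩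
  have hgc : qExpansion 1 d = castSeries ℂ (G - PowerSeries.C c * ε) := by
    rw [hd, FunLike.coe_sub, ModularForm.qExpansion_sub one_pos one_mem_strictPeriods_SL,
      FunLike.coe_smul, ModularForm.qExpansion_smul one_pos one_mem_strictPeriods_SL, hG, he',
      map_sub, map_mul, PowerSeries.smul_eq_C_mul, PowerSeries.map_C, eq_intCast]
  have hcusp : (qExpansion 1 d).coeff 0 = 0 := by
    rw [hgc]
    simp only [PowerSeries.coeff_map, map_sub, PowerSeries.coeff_C_mul, hε0, ← hc]
    simp
  have hfac := qExpansion_eq_qExpansion_discriminant_mul _ hcusp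
  set g' := CuspForm.discriminantEquiv (toCuspForm _ hcusp) with hg'
  have hGX : ∃ K, G - PowerSeries.C c * ε = PowerSeries.X * K := by
    apply PowerSeries.X_dvd_iff.mpr
    rw [← PowerSeries.coeff_zero_eq_constantCoeff_apply]
    rw [map_sub, PowerSeries.coeff_C_mul, hε0, ← hc]
    simp
  obtain ⟨K, hK⟩ := hGX
  have hK' : G - PowerSeries.C c * ε =
      PowerSeries.X * discriminantUnit * (K * discriminantInv) := by
    rw [hK]
    linear_combination (-PowerSeries.X * K) * discriminantUnit_mul_inv
  set G' := K * discriminantInv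
  have hq' : qExpansion 1 g' = castSeries ℂ G' := by
    rw [hgc, hK', qExpansion_discriminant, ← X_mul_discriminantUnit, map_mul] at hfac
    refine (mul_left_cancel₀ ?_ hfac).symm
    rw [X_mul_discriminantUnit, ← qExpansion_discriminant]
    intro h0
    have := discriminant_qExpansion_order
    rw [h0, PowerSeries.order_zero] at this
    exact absurd this (by decide)
  -- Over `R` the subtracted multiple vanishes, so the reduction of `G` is that of `Δ` times that of
  -- `G'`, and one power of `X` is used up.
  have hcR : (c : R) = 0 := by
    have h1 : PowerSeries.X ∣ castSeries R G := (dvd_pow_self _ (by omega)).trans h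
    have h2 := PowerSeries.X_dvd_iff.mp h1
    rw [← PowerSeries.coeff_zero_eq_constantCoeff_apply, PowerSeries.coeff_map] at h2
    exact h2
  have hred : castSeries R G = PowerSeries.X * (castSeries R discriminantUnit * castSeries R G') := by
    have := congrArg (castSeries R) hK'
    rw [map_sub, map_mul, PowerSeries.map_C, eq_intCast, hcR, map_zero, zero_mul, sub_zero] at this
    rw [this]
    simp [mul_assoc]
  have hred' : castSeries R G' = 0 := by
    rcases lt_or_ge w 12 with hw12 | hw12
    · have hz : g' = 0 := rank_zero_iff_forall_zero.mp (levelOne_neg_weight_rank_zero (by omega)) g'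
      have : G' = 0 := castSeries_complex_injective (by
        rw [← hq', map_zero, hz]
        exact UpperHalfPlane.qExpansion_zero 1)
      rw [this, map_zero]
    · refine ih (w - 12) (by omega) (ModularForm.mcast (by omega) g') G' hq' ?_
      have h1 : w / 12 + 1 = ((w - 12) / 12 + 1) + 1 := by omega
      rw [h1, pow_succ', hred] at h
      have h2 : PowerSeries.X ^ ((w - 12) / 12 + 1) ∣
          castSeries R discriminantUnit * castSeries R G' := by
        obtain ⟨T, hT⟩ := h
        refine ⟨T, PowerSeries.X_mul_cancel ?_⟩
        rw [hT, mul_assoc]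
      have h3 : castSeries R G' = castSeries R discriminantInv *
          (castSeries R discriminantUnit * castSeries R G') := by
        rw [← map_mul, ← map_mul, ← mul_assoc, mul_comm discriminantInv, discriminantUnit_mul_inv,
          one_mul]
      rw [h3]
      exact h2.mul_left _
  rw [hred, hred', mul_zero, mul_zero]

/-! ### Integral Laurent coefficients and Klein's `j` -/

/-- The coefficients of the Laurent series `q^{-N} P(q)`. -/
def laurentCoeff {R : Type*} [Semiring R] (N : ℕ) (P : R⟦X⟧) (n : ℤ) : R :=
  if 0 ≤ n + N then PowerSeries.coeff (n + N).toNat P else 0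

lemma laurentCoeff_of_lt {R : Type*} [Semiring R] {N : ℕ} (P : R⟦X⟧) {n : ℤ} (h : n < -(N : ℤ)) :
    laurentCoeff N P n = 0 := if_neg (by omega)

lemma laurentCoeff_eq {R : Type*} [Semiring R] {N : ℕ} (P : R⟦X⟧) {n : ℤ} {m : ℕ}
    (h : n + N = m) : laurentCoeff N P n = PowerSeries.coeff m P := by
  rw [laurentCoeff, if_pos (by omega), h, Int.toNat_natCast]

lemma shiftedSeries_laurentCoeff {R : Type*} [Semiring R] (N : ℕ) (P : R⟦X⟧) :
    shiftedSeries N (laurentCoeff N P) = P := by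
  ext m
  rw [shiftedSeries, PowerSeries.coeff_mk, laurentCoeff_eq P (m := m) (by ring)]

lemma laurentCoeff_castSeries (R : Type*) [CommRing R] (N : ℕ) (P : ℤ⟦X⟧) :
    laurentCoeff N (castSeries R P) = fun n => ((laurentCoeff N P n : ℤ) : R) := by
  ext n
  unfold laurentCoeff
  split_ifs <;> simp

lemma hasLaurentQExpansion_laurentCoeff_iff {f : ℍ → ℂ} {N : ℕ} {P : ℤ⟦X⟧} :
    HasLaurentQExpansion f (fun n => ((laurentCoeff N P n : ℤ) : ℂ)) ↔
      HasQSeries (nome ^ N * f) (castSeries ℂ P) := by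
  rw [← laurentCoeff_castSeries, hasLaurentQExpansion_iff fun n hn => laurentCoeff_of_lt _ hn,
    shiftedSeries_laurentCoeff]

lemma modularForm_slash {w : ℤ} (e : ModularForm 𝒮ℒ w) (γ : SL(2, ℤ)) : ⇑e ∣[w] γ = e :=
  e.slash_action_eq' _ ⟨γ, rfl⟩

lemma IsWeakForm.of_modularForm {w : ℤ} (e : ModularForm 𝒮ℒ w) {P : ℤ⟦X⟧}
    (he : qExpansion 1 e = castSeries ℂ P) :
    IsWeakForm w e fun n => ((laurentCoeff 0 P n : ℤ) : ℂ) where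
  holomorphic := e.holo'
  slash := modularForm_slash e
  expansion := by
    rw [hasLaurentQExpansion_laurentCoeff_iff, pow_zero, one_mul, ← he]
    exact HasQSeries.of_modularForm e

lemma IsWeakForm.mul_modularForm {w v : ℤ} {f : ℍ → ℂ} {N : ℕ} {P Q : ℤ⟦X⟧}
    (hf : IsWeakForm w f fun n => ((laurentCoeff N P n : ℤ) : ℂ)) (e : ModularForm 𝒮ℒ v)
    (he : qExpansion 1 e = castSeries ℂ Q) :
    IsWeakForm (w + v) (f * e) fun n => ((laurentCoeff N (P * Q) n : ℤ) : ℂ) where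
  holomorphic := hf.holomorphic.mul e.holo'
  slash γ := by rw [mul_slash_SL2, hf.slash, modularForm_slash]
  expansion := by
    rw [hasLaurentQExpansion_laurentCoeff_iff, map_mul, ← mul_assoc, ← he]
    exact (hasLaurentQExpansion_laurentCoeff_iff.mp hf.expansion).mul (HasQSeries.of_modularForm e)

/-- The discriminant as a modular form. -/
def discriminantForm : ModularForm 𝒮ℒ 12 :=
  ⟨CuspForm.discriminant.toSlashInvariantForm, CuspForm.discriminant.holo',
    ModularFormClass.bdd_at_cusps CuspForm.discriminant⟩

lemma coe_discriminantForm : ⇑discriminantForm = discriminant := rfl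

/-- Klein's modular function. -/
def kleinJ : ℍ → ℂ := ⇑E₄ ^ 3 / discriminant

/-- The power series `q j`. -/
def kleinSeries : ℤ⟦X⟧ := eisensteinFour ^ 3 * discriminantInv

lemma isWeakForm_kleinJ : IsWeakForm 0 kleinJ fun n => ((laurentCoeff 1 kleinSeries n : ℤ) : ℂ) where
  holomorphic := by
    have h : MDifferentiable 𝓘(ℂ) 𝓘(ℂ) (⇑E₄ ^ 3) := by
      rw [← ModularForm.coe_pow]
      exact (E₄.pow 3).holo'
    exact h.div CuspForm.discriminant.holo' discriminant_ne_zero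
  slash γ := by
    have h1 : (⇑E₄ ^ 3) ∣[(12 : ℤ)] γ = ⇑E₄ ^ 3 := by
      rw [← ModularForm.coe_pow]
      exact modularForm_slash (ModularForm.mcast (by norm_num) (E₄.pow 3) : ModularForm 𝒮ℒ 12) γ
    have h2 : discriminant ∣[(12 : ℤ)] γ = discriminant := modularForm_slash discriminantForm γ
    have h3 := div_slash_SL2 12 12 γ (⇑E₄ ^ 3) discriminant
    rw [h1, h2] at h3
    exact h3
  expansion := by
    rw [hasLaurentQExpansion_laurentCoeff_iff, kleinSeries, map_mul, map_pow]
    have h := (hasQSeries_E₄.pow 3).mul hasQSeries_nome_div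
    have h1 : nome ^ 1 * kleinJ = ⇑E₄ ^ 3 * (nome / discriminant) := by
      rw [kleinJ, pow_one, mul_div_left_comm]
    rwa [h1]

/-! ### Congruences for the coefficients of `j` -/

/-- If the coefficients of an integral weakly holomorphic form of weight `w` are divisible by `M` up
to the Sturm bound, then they are all divisible by `M`. -/
theorem IsWeakForm.dvd_coeff_of_le {w : ℕ} {f : ℍ → ℂ} {c : ℤ → ℤ}
    (hf : IsWeakForm w f fun n => (c n : ℂ)) (M : ℕ)
    (h : ∀ n : ℤ, n ≤ (w / 12 : ℕ) → (M : ℤ) ∣ c n) (n : ℤ) : (M : ℤ) ∣ c n := by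
  obtain ⟨N, hN⟩ := hf.expansion.exists_bound
  have hN' : ∀ n < -(N : ℤ), c n = 0 := fun n hn => by exact_mod_cast hN n hn
  set P : ℤ⟦X⟧ := shiftedSeries N c with hP
  have hcP : castSeries ℂ P = shiftedSeries N fun n => (c n : ℂ) := by
    ext m
    simp [hP, shiftedSeries]
  have hq := (hasLaurentQExpansion_iff hN).mp hf.expansion
  rw [← hcP] at hq
  -- Multiplying by `Δ^N` removes the pole. It raises the weight by `12N` and the Sturm bound by
  -- `N`, exactly the shift of the exponents.
  have hF := hq.mul (hasQSeries_discriminant_div.pow N)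
  rw [← map_pow, ← map_mul] at hF
  have hFf : nome ^ N * f * (discriminant / nome) ^ N = f * discriminant ^ N := by
    ext τ
    have := pow_ne_zero N (nome_ne_zero τ)
    simp only [Pi.mul_apply, Pi.pow_apply, Pi.div_apply, div_pow]
    field_simp
  rw [hFf] at hF
  obtain ⟨g, -, hg⟩ := exists_modularForm (w := ((w + 12 * N : ℕ) : ℤ))
    (by
      have h1 := (discriminantForm.pow N).holo'
      have h2 : MDifferentiable 𝓘(ℂ) 𝓘(ℂ) (discriminant ^ N) := by
        rw [← coe_discriminantForm, ← ModularForm.coe_pow]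
        exact h1
      exact hf.holomorphic.mul h2)
    (fun γ => by
      have h1 := modularForm_slash (discriminantForm.pow N) γ
      rw [ModularForm.coe_pow, coe_discriminantForm] at h1
      have h2 := mul_slash_SL2 w (N * 12) γ f (discriminant ^ N)
      rw [hf.slash, h1] at h2
      rw [show ((w + 12 * N : ℕ) : ℤ) = w + N * 12 by push_cast; ring]
      exact h2) hF
  have hX : PowerSeries.X ^ (w / 12 + N + 1) ∣ castSeries (ZMod M) P := by
    rw [PowerSeries.X_pow_dvd_iff]
    intro m hm
    rw [PowerSeries.coeff_map, hP, shiftedSeries, PowerSeries.coeff_mk]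
    exact (ZMod.intCast_zmod_eq_zero_iff_dvd _ M).mpr (h _ (by push_cast; omega))
  have hzero := castSeries_eq_zero_of_X_pow_dvd (ZMod M) (w + 12 * N) g _ hg (by
    rw [show (w + 12 * N) / 12 + 1 = w / 12 + N + 1 by omega, map_mul]
    exact hX.mul_right _)
  have hPz : castSeries (ZMod M) P = 0 := by
    have h1 : castSeries (ZMod M) P = castSeries (ZMod M) (P * discriminantUnit ^ N) *
        castSeries (ZMod M) (discriminantInv ^ N) := by
      rw [← map_mul, mul_assoc, ← mul_pow, discriminantUnit_mul_inv, one_pow, mul_one]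
    rw [h1, hzero, zero_mul]
  by_cases hn : n < -(N : ℤ)
  · rw [hN' n hn]
    exact dvd_zero _
  · have h1 := congrArg (PowerSeries.coeff (n + N).toNat) hPz
    rw [PowerSeries.coeff_map, hP, shiftedSeries, PowerSeries.coeff_mk,
      Int.toNat_of_nonneg (by omega), add_sub_cancel_right, map_zero] at h1
    exact (ZMod.intCast_zmod_eq_zero_iff_dvd _ M).mp h1

lemma coeff_zero_kleinSeries : PowerSeries.coeff 0 kleinSeries = 1 := by
  have h := congrArg PowerSeries.constantCoeff discriminantUnit_mul_inv
  rw [map_mul, constantCoeff_discriminantUnit, one_mul, map_one] at h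
  have h1 := constantCoeff_eisenstein_monomial 3 0
  simp only [pow_zero, mul_one, PowerSeries.coeff_zero_eq_constantCoeff_apply] at h1
  rw [PowerSeries.coeff_zero_eq_constantCoeff_apply, kleinSeries, map_mul, h, h1, mul_one]

/-- The congruence for the coefficients of `j`, given an integral modular form congruent to `1` and
a check of the coefficients up to the Sturm bound. -/
theorem dvd_coeff_kleinJ (p : ℕ) [Fact p.Prime] (M : ℕ) (w : ℕ) (hw : 1 ≤ w)
    (hM : (M : ℤ) ∣ (p : ℤ) ^ (w - 1)) (e : ModularForm 𝒮ℒ w) (ε : ℤ⟦X⟧)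
    (he : qExpansion 1 e = castSeries ℂ ε) (hε : castSeries (ZMod M) ε = 1)
    (hcheck : ∀ n : ℕ, 1 ≤ n → n ≤ w / 12 → (M : ℤ) ∣ PowerSeries.coeff (p * n + 1) kleinSeries)
    (n : ℤ) (hn : n ≠ 0) : (M : ℤ) ∣ laurentCoeff 1 kleinSeries (p * n) := by
  have hp := (Fact.out : p.Prime)
  have hp2 : (2 : ℤ) ≤ p := by exact_mod_cast hp.two_le
  have hpC : (p : ℂ) ≠ 0 := NeZero.ne _
  set c := laurentCoeff 1 kleinSeries
  set a := laurentCoeff 1 (kleinSeries * ε) with ha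
  have hF : IsWeakForm w (kleinJ * e) fun n => (a n : ℂ) := by
    have := isWeakForm_kleinJ.mul_modularForm e he
    rwa [zero_add] at this
  have hac : ∀ n, (a n : ZMod M) = c n := by
    intro n
    have h1 := congrFun (laurentCoeff_castSeries (ZMod M) 1 (kleinSeries * ε)) n
    have h2 := congrFun (laurentCoeff_castSeries (ZMod M) 1 kleinSeries) n
    rw [map_mul, hε, mul_one] at h1
    exact h1.symm.trans h2
  set c₀ := c 0
  -- The coefficients of `T_p(jε) - c(0) ε`, where `T_p` is `1/p` times `heckeOperator`. Modulo `M`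
  -- they are `c(pn)`, with the constant term cancelled.
  set h : ℤ → ℤ := fun n => (a (p * n) + if (p : ℤ) ∣ n then (p : ℤ) ^ (w - 1) * a (n / p) else 0) -
    c₀ * laurentCoeff 0 ε n with hh
  have hform := ((hF.heckeOperator p).smul (1 / (p : ℂ))).add
    ((IsWeakForm.of_modularForm e he).smul (-(c₀ : ℂ)))
  have hcoef : (1 / (p : ℂ)) • heckeCoeff p ((p : ℂ) ^ (w : ℤ)) (fun n => (a n : ℂ)) +
      (-(c₀ : ℂ)) • (fun n => ((laurentCoeff 0 ε n : ℤ) : ℂ)) = fun n => (h n : ℂ) := by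
    ext n
    have hpw : (p : ℂ) ^ (w : ℤ) = p * (p : ℂ) ^ (w - 1) := by
      rw [zpow_natCast, ← pow_succ', Nat.sub_add_cancel hw]
    simp only [Pi.add_apply, Pi.smul_apply, smul_eq_mul, heckeCoeff, hpw, hh]
    split_ifs
    · push_cast
      field_simp
      ring
    · push_cast
      field_simp
      ring
  rw [hcoef] at hform
  have hmod : ∀ n, (h n : ZMod M) = c (p * n) - if n = 0 then (c₀ : ZMod M) else 0 := by
    intro n
    have hM0 : ((p : ZMod M)) ^ (w - 1) = 0 := by
      have := (ZMod.intCast_zmod_eq_zero_iff_dvd _ M).mpr hM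
      simpa using this
    have h1 : ((laurentCoeff 0 ε n : ℤ) : ZMod M) = if n = 0 then 1 else 0 := by
      have h2 := congrFun (laurentCoeff_castSeries (ZMod M) 0 ε) n
      rw [hε] at h2
      rw [← h2, laurentCoeff]
      by_cases hn : n = 0
      · simp [hn]
      · rw [if_neg hn]
        split_ifs with h3
        · rw [PowerSeries.coeff_one, if_neg (by simp at h3 ⊢; omega)]
        · rfl
    simp only [hh]
    push_cast
    rw [h1, hac]
    split_ifs <;> simp [hM0]
  have hsmall : ∀ n : ℤ, n ≤ (w / 12 : ℕ) → (M : ℤ) ∣ h n := by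
    intro n hnw
    rw [← ZMod.intCast_zmod_eq_zero_iff_dvd, hmod]
    rcases lt_trichotomy n 0 with hlt | rfl | hgt
    · have h1 : c (p * n) = 0 := laurentCoeff_of_lt _ (by push_cast; nlinarith)
      rw [if_neg hlt.ne, h1]
      simp
    · simp [c₀]
    · rw [if_neg hgt.ne', sub_zero, ZMod.intCast_zmod_eq_zero_iff_dvd]
      obtain ⟨m, rfl⟩ := Int.eq_ofNat_of_zero_le hgt.le
      have := hcheck m (by exact_mod_cast hgt) (by exact_mod_cast hnw)
      have h1 : c (p * (m : ℤ)) = _ :=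
        laurentCoeff_eq (m := p * m + 1) kleinSeries (by push_cast; ring)
      exact h1 ▸ this
  have hall := hform.dvd_coeff_of_le M hsmall n
  rwa [← ZMod.intCast_zmod_eq_zero_iff_dvd, hmod, if_neg hn, sub_zero,
    ZMod.intCast_zmod_eq_zero_iff_dvd] at hall

/-! ### Modular functions with prescribed principal part -/

lemma IsWeakForm.zero (w : ℤ) : IsWeakForm w 0 fun n => (((0 : ℤ → ℤ) n : ℤ) : ℂ) where
  holomorphic := mdifferentiable_const
  slash γ := SlashAction.zero_slash w γ
  expansion := ⟨⟨0, fun n _ => by simp⟩, fun τ => by simp⟩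

lemma isWeakForm_one : IsWeakForm 0 1 fun n => (((if n = 0 then 1 else 0 : ℤ)) : ℂ) := by
  have h := IsWeakForm.of_modularForm (1 : ModularForm 𝒮ℒ 0) (P := 1) (by
    rw [map_one]
    exact ModularForm.qExpansion_one)
  have h1 : (fun n : ℤ => ((laurentCoeff 0 (1 : ℤ⟦X⟧) n : ℤ) : ℂ)) =
      fun n => (((if n = 0 then 1 else 0 : ℤ)) : ℂ) := by
    ext n
    rw [laurentCoeff]
    by_cases hn : n = 0
    · simp [hn]
    · rw [if_neg hn]
      split_ifs with h3
      · rw [PowerSeries.coeff_one, if_neg (by simp at h3 ⊢; omega)]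
      · rfl
  rw [h1] at h
  exact h

lemma IsWeakForm.add_int_smul {w : ℤ} {f g : ℍ → ℂ} {c d : ℤ → ℤ}
    (hf : IsWeakForm w f fun n => (c n : ℂ)) (hg : IsWeakForm w g fun n => (d n : ℂ)) (t : ℤ) :
    IsWeakForm w (f + (t : ℂ) • g) fun n => ((c n + t * d n : ℤ) : ℂ) := by
  have h := hf.add (hg.smul t)
  have h1 : ((fun n => (c n : ℂ)) + (t : ℂ) • fun n => (d n : ℂ)) =
      fun n => ((c n + t * d n : ℤ) : ℂ) := by
    ext n
    simp
  rwa [h1] at h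

lemma IsWeakForm.heckeOperator_weight_zero {f : ℍ → ℂ} {c : ℤ → ℤ}
    (hf : IsWeakForm 0 f fun n => (c n : ℂ)) (l : ℕ) [Fact l.Prime] :
    IsWeakForm 0 (ExtremalCFT.heckeOperator l 0 f) fun n => ((heckeCoeff l 1 c n : ℤ) : ℂ) := by
  have h := hf.heckeOperator l
  have h1 : heckeCoeff l ((l : ℂ) ^ (0 : ℤ)) (fun n => (c n : ℂ)) =
      fun n => ((heckeCoeff l 1 c n : ℤ) : ℂ) := by
    ext n
    unfold heckeCoeff
    split_ifs <;> simp
  rwa [h1] at h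

section

variable {p : ℕ} [Fact p.Prime] {M : ℤ}
  (hj : ∀ n : ℤ, n ≠ 0 → M ∣ laurentCoeff 1 kleinSeries (p * n))
include hj

/-- For `m` prime to `p`, an integral modular function `q^{-m} + O(1)` satisfying the same
congruences as `j`. -/
lemma exists_modular_function_single_pole (m : ℕ) (hm : 0 < m) (hpm : ¬ p ∣ m) :
    ∃ (f : ℍ → ℂ) (c : ℤ → ℤ), IsWeakForm 0 f (fun n => (c n : ℂ)) ∧
      (∀ n < 0, c n = if n = -(m : ℤ) then 1 else 0) ∧ ∀ n : ℤ, n ≠ 0 → M ∣ c (p * n) := by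
  induction m using Nat.strong_induction_on with
  | _ m ih =>
  by_cases hm1 : m = 1
  · subst hm1
    refine ⟨kleinJ, laurentCoeff 1 kleinSeries, isWeakForm_kleinJ, fun n hn => ?_, hj⟩
    by_cases h : n = -1
    · subst h
      rw [laurentCoeff_eq (m := 0) _ (by norm_num), coeff_zero_kleinSeries]
      simp
    · rw [laurentCoeff_of_lt _ (by push_cast; omega), if_neg (by push_cast; omega)]
  have hl : (m.minFac).Prime := Nat.minFac_prime hm1
  obtain ⟨m', hm'⟩ := m.minFac_dvd
  generalize m.minFac = l at hl hm'
  have : Fact l.Prime := ⟨hl⟩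
  have hl2 := hl.two_le
  have hm'0 : 0 < m' := Nat.pos_of_ne_zero (by rintro rfl; omega)
  have hpm' : ¬ p ∣ m' := fun h => hpm (hm' ▸ h.mul_left l)
  have hpl : ¬ p ∣ l := fun h => hpm (hm' ▸ h.mul_right m')
  have hlp : IsCoprime (l : ℤ) p := by
    rw [Nat.isCoprime_iff_coprime]
    exact ((Nat.Prime.coprime_iff_not_dvd Fact.out).mpr hpl).symm
  obtain ⟨f, c, hf, hc, hcM⟩ := ih m' (by nlinarith) hm'0 hpm'
  -- With `m = lm'`, the Hecke operator sends `q^{-m'}` to `q^{-m}`, plus `l q^{-m'/l}` when `l ∣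
  -- m'`. The function `g` serves to cancel the second term and is zero when `l ∤ m'`.
  obtain ⟨g, d, hg, hd, hdM⟩ : ∃ (g : ℍ → ℂ) (d : ℤ → ℤ), IsWeakForm 0 g (fun n => (d n : ℂ)) ∧
      (∀ n < 0, d n = if l * n = -(m' : ℤ) then 1 else 0) ∧ ∀ n : ℤ, n ≠ 0 → M ∣ d (p * n) := by
    by_cases hlm : l ∣ m'
    · obtain ⟨m'', rfl⟩ := hlm
      obtain ⟨g, d, hg, hd, hdM⟩ := ih m'' (by nlinarith) (Nat.pos_of_ne_zero (by rintro rfl; omega))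
        (fun h => hpm' (h.mul_left l))
      refine ⟨g, d, hg, fun n hn => ?_, hdM⟩
      rw [hd n hn]
      congr 1
      have hl0 : (l : ℤ) ≠ 0 := by omega
      rw [Nat.cast_mul, ← mul_neg, mul_right_inj' hl0]
    · refine ⟨0, 0, IsWeakForm.zero 0, fun n _ => ?_, fun n _ => dvd_zero _⟩
      rw [if_neg]
      · rfl
      · intro h
        apply hlm
        have : (l : ℤ) ∣ m' := ⟨-n, by rw [mul_neg, h, neg_neg]⟩
        exact_mod_cast this
  refine ⟨_, _, hf.heckeOperator_weight_zero l |>.add_int_smul hg (-l), fun n hn => ?_,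
    fun n hn => ?_⟩
  · have hln : (l : ℤ) * n < 0 := by nlinarith
    rw [heckeCoeff, hd n hn, hc _ hln, hm']
    push_cast
    by_cases hdvd : (l : ℤ) ∣ n
    · obtain ⟨k, rfl⟩ := hdvd
      have hl0 : (l : ℤ) ≠ 0 := by omega
      have h1 : (l : ℤ) * k = -(l * m' : ℤ) ↔ k = -(m' : ℤ) := by
        rw [← mul_neg, mul_right_inj' hl0]
      rw [if_pos (dvd_mul_right _ _), Int.mul_ediv_cancel_left _ hl0, hc k (by nlinarith)]
      simp only [h1]
      ring
    · have h1 : n ≠ -(l * m' : ℤ) := fun h => hdvd ⟨-(m' : ℤ), by rw [h, mul_neg]⟩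
      rw [if_neg hdvd, if_neg h1]
      ring
  · refine dvd_add (dvd_add ?_ ?_) ((hdM n hn).mul_left _)
    · rw [mul_left_comm]
      exact (hcM _ (mul_ne_zero (by omega) hn)).mul_left _
    · split_ifs with h
      -- Because `l` is prime to `p`, `l ∣ pn` forces `l ∣ n`, so `pn/l` is again a nonzero multiple
      -- of `p`.
      · obtain ⟨k, rfl⟩ := hlp.dvd_of_dvd_mul_left h
        rw [mul_left_comm, Int.mul_ediv_cancel_left _ (by omega), one_mul]
        exact hcM k (right_ne_zero_of_mul hn)
      · exact dvd_zero _

/-- Poles are added one order at a time; orders divisible by `p` are skipped, having coefficient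
zero. A constant then corrects the coefficient at `n = 0`, which the congruences ignore. -/
lemma exists_modular_function_principal_part (k : ℕ) (r : ℕ → ℤ)
    (hr : ∀ m, 0 < m → m ≤ k → p ∣ m → r m = 0) :
    ∃ (f : ℍ → ℂ) (c : ℤ → ℤ), IsWeakForm 0 f (fun n => (c n : ℂ)) ∧
      (∀ n ≤ 0, c n = if -(k : ℤ) ≤ n then r n.natAbs else 0) ∧ ∀ n : ℤ, n ≠ 0 → M ∣ c (p * n) := by
  have key : ∃ (f : ℍ → ℂ) (c : ℤ → ℤ), IsWeakForm 0 f (fun n => (c n : ℂ)) ∧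
      (∀ n < 0, c n = if -(k : ℤ) ≤ n then r n.natAbs else 0) ∧
        ∀ n : ℤ, n ≠ 0 → M ∣ c (p * n) := by
    induction k with
    | zero => exact ⟨0, 0, IsWeakForm.zero 0, fun n hn => by simp; omega, fun n _ => dvd_zero _⟩
    | succ k ih =>
      obtain ⟨f, c, hf, hc, hcM⟩ := ih fun m h0 hm => hr m h0 (by omega)
      by_cases hpk : p ∣ k + 1
      · refine ⟨f, c, hf, fun n hn => ?_, hcM⟩
        rw [hc n hn]
        by_cases h : n = -((k : ℤ) + 1)
        · rw [if_neg (by omega), if_pos (by push_cast; omega), show n.natAbs = k + 1 by omega,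
            hr (k + 1) (by omega) le_rfl hpk]
        · congr 1
          push_cast
          apply propext
          omega
      · obtain ⟨g, d, hg, hd, hdM⟩ := exists_modular_function_single_pole hj (k + 1) (by omega) hpk
        refine ⟨_, _, hf.add_int_smul hg (r (k + 1)), fun n hn => ?_,
          fun n hn => dvd_add (hcM n hn) ((hdM n hn).mul_left _)⟩
        rw [hc n hn, hd n hn]
        by_cases h : n = -((k : ℤ) + 1)
        · rw [if_neg (by omega), if_pos (by push_cast; omega), if_pos (by push_cast; omega),
            show n.natAbs = k + 1 by omega]
          ring
        · rw [if_neg (c := n = -((k + 1 : ℕ) : ℤ)) (by push_cast; omega), mul_zero, add_zero]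
          congr 1
          push_cast
          apply propext
          omega
  obtain ⟨f, c, hf, hc, hcM⟩ := key
  refine ⟨_, _, hf.add_int_smul isWeakForm_one (r 0 - c 0), fun n hn => ?_, fun n hn => ?_⟩
  · rcases hn.lt_or_eq with h | rfl
    · simp [hc n h, h.ne]
    · simp
  · have hp0 : (p : ℤ) * n ≠ 0 := mul_ne_zero (by exact_mod_cast (Fact.out : p.Prime).ne_zero) hn
    simpa [hp0] using! hcM n hn

end

/-! ### Uniqueness, the vacuum product and the reduction to `j` -/

lemma isWeakForm_zero_iff {f : ℍ → ℂ} {a : ℤ → ℂ} :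
    IsWeakForm 0 f a ↔ IsWeaklyHolomorphicModularFunction f ∧ HasLaurentQExpansion f a := by
  have key : ∀ γ : SL(2, ℤ), f ∣[(0 : ℤ)] γ = f ↔ ∀ τ, f (γ • τ) = f τ := by
    intro γ
    rw [funext_iff]
    simp [SL_slash_apply]
  constructor
  · intro h
    exact ⟨⟨h.holomorphic, fun γ => (key γ).mp (h.slash γ), a, h.expansion⟩, h.expansion⟩
  · rintro ⟨h, ha⟩
    exact ⟨h.holomorphic, fun γ => (key γ).mpr (h.invariant γ), ha⟩

lemma IsWeakForm.eq_zero_of_coeff_nonpos {f : ℍ → ℂ} {a : ℤ → ℂ} (hf : IsWeakForm 0 f a)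
    (ha : ∀ n ≤ 0, a n = 0) : f = 0 := by
  have h := (hasLaurentQExpansion_iff (N := 0) fun n hn => ha n (by simpa using hn.le)).mp
    hf.expansion
  rw [pow_zero, one_mul] at h
  obtain ⟨g, hg, hq⟩ := exists_modularForm hf.holomorphic hf.slash h
  have : g = 0 := by
    refine sturm_bound_levelOne (k := 0) ?_
    have h1 : ((1 : ℕ) : ℕ∞) ≤ (qExpansion 1 g).order := by
      refine PowerSeries.nat_le_order _ _ fun i hi => ?_
      rw [hq, shiftedSeries, PowerSeries.coeff_mk]
      exact ha _ (by omega)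
    exact lt_of_lt_of_le (by simp) h1
  rw [← hg, this]
  rfl

open scoped PowerSeries.WithPiTopology in
/-- The coefficients of `∏_{n ≥ 2} 1 / (1 - qⁿ)` are integers, and that of `q` vanishes. -/
lemma exists_vacuumProduct_eq :
    ∃ V : ℤ⟦X⟧, castSeries ℂ V = vacuumProduct ∧ PowerSeries.coeff 1 V = 0 := by
  -- Both properties survive multiplication and coefficientwise limits (`ℤ` is closed in `ℂ`), so
  -- they pass from the factors to the infinite product.
  let S : Submonoid ℂ⟦X⟧ :=
    { carrier := {P | (∀ n, PowerSeries.coeff n P ∈ Set.range ((↑) : ℤ → ℂ)) ∧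
        PowerSeries.coeff 1 P = 0}
      one_mem' := by
        refine ⟨fun n => ?_, by simp [PowerSeries.coeff_one]⟩
        rw [PowerSeries.coeff_one]
        split_ifs
        exacts [⟨1, by simp⟩, ⟨0, by simp⟩]
      mul_mem' := by
        rintro P Q ⟨hP, hP1⟩ ⟨hQ, hQ1⟩
        refine ⟨fun n => ?_, ?_⟩
        · rw [PowerSeries.coeff_mul]
          exact sum_mem (S := (Int.castRingHom ℂ).range) fun x _ => mul_mem (hP _) (hQ _)
        · rw [PowerSeries.coeff_mul]
          simp [Finset.Nat.antidiagonal_succ, hP1, hQ1] }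
  have hclosed : IsClosed (S : Set ℂ⟦X⟧) := by
    have h1 : (S : Set ℂ⟦X⟧) = (⋂ n, PowerSeries.coeff n ⁻¹' Set.range ((↑) : ℤ → ℂ)) ∩
        PowerSeries.coeff 1 ⁻¹' {0} := by
      ext P
      simp [S]
    rw [h1]
    refine (isClosed_iInter fun n => ?_).inter ?_
    · exact Complex.isClosed_range_intCast.preimage
        (PowerSeries.WithPiTopology.continuous_coeff ℂ n)
    · exact isClosed_singleton.preimage (PowerSeries.WithPiTopology.continuous_coeff ℂ 1)
  have hfac : ∀ n : ℕ, ((1 : ℂ⟦X⟧) - PowerSeries.X ^ (n + 2))⁻¹ ∈ S := by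
    intro n
    set u : ℤ⟦X⟧ := 1 - PowerSeries.X ^ (n + 2) with hu
    set v := PowerSeries.invOfUnit u 1
    have huv : u * v = 1 := PowerSeries.mul_invOfUnit _ _ (by simp [hu])
    have hv : ((1 : ℂ⟦X⟧) - PowerSeries.X ^ (n + 2))⁻¹ = castSeries ℂ v := by
      have h1 : castSeries ℂ u = 1 - PowerSeries.X ^ (n + 2) := by simp [hu]
      rw [PowerSeries.inv_eq_iff_mul_eq_one (by simp), ← h1, ← map_mul, mul_comm, huv, map_one]
    rw [hv]
    refine ⟨fun m => ⟨PowerSeries.coeff m v, by simp⟩, ?_⟩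
    have h2 : v = 1 + PowerSeries.X ^ 2 * (PowerSeries.X ^ n * v) := by
      rw [← mul_assoc, ← pow_add, add_comm 2 n]
      linear_combination huv
    rw [PowerSeries.coeff_map, h2, map_add, PowerSeries.coeff_one, PowerSeries.coeff_X_pow_mul']
    simp
  have hmem : vacuumProduct ∈ S := by
    refine hclosed.mem_of_tendsto multipliable_vacuumProduct.hasProd (Filter.Eventually.of_forall ?_)
    intro s
    exact prod_mem fun n _ => hfac n
  choose z hz using hmem.1
  refine ⟨PowerSeries.mk z, ?_, ?_⟩
  · ext n
    simp [hz]
  · have := hmem.2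
    rw [← hz 1] at this
    rw [PowerSeries.coeff_mk]
    exact_mod_cast this

lemma coeff_vacuumCharacter (k : ℕ) (n : ℤ) :
    (vacuumCharacter k).coeff n = laurentCoeff k vacuumProduct n := by
  rw [vacuumCharacter, HahnSeries.coeff_single_mul, one_mul, sub_neg_eq_add, laurentCoeff]
  split_ifs with h
  · obtain ⟨m, hm⟩ := Int.eq_ofNat_of_zero_le h
    rw [hm, Int.toNat_natCast]
    exact HahnSeries.ofPowerSeries_apply_coeff _ m
  · rw [HahnSeries.ofPowerSeries_apply]
    apply HahnSeries.embDomain_of_notMem_range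
    rintro ⟨m, hm⟩
    apply h
    rw [← hm]
    simp

/-- Existence, uniqueness and congruences of extremal partition functions, given the congruences
for `j`. -/
theorem extremalPartitionFunction_of_dvd_coeff_kleinJ {p k : ℕ} [Fact p.Prime] {M : ℤ}
    (hj : ∀ n : ℤ, n ≠ 0 → M ∣ laurentCoeff 1 kleinSeries (p * n))
    (hk : (1 ≤ k ∧ k ≤ p - 1) ∨ k = p + 1) :
    (∃! Z : ℍ → ℂ, IsExtremalPartitionFunction k Z) ∧
    ∀ (Z : ℍ → ℂ) (w : ℤ → ℂ), IsExtremalPartitionFunction k Z → HasLaurentQExpansion Z w →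
      ∃ c : ℤ → ℤ, (∀ n : ℤ, w n = (c n : ℂ)) ∧ ∀ n : ℤ, n ≠ 0 → M ∣ c (p * n) := by
  have hp2 := (Fact.out : p.Prime).two_le
  obtain ⟨V, hV, hV1⟩ := exists_vacuumProduct_eq
  obtain ⟨f, c, hf, hc, hcM⟩ := exists_modular_function_principal_part hj k
    (fun m => PowerSeries.coeff (k - m) V) (by
      intro m hm0 hmk hpm
      have hle := Nat.le_of_dvd hm0 hpm
      rcases hk with hk | hk
      · omega
      -- In `1, …, p + 1` the only multiple of `p` is `p` itself, and its coefficient is that of `q`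
      -- in the vacuum product.
      · have : m = p := by
          obtain ⟨t, rfl⟩ := hpm
          have : t = 1 := by
            by_contra ht
            have : 2 ≤ t := by
              have : t ≠ 0 := by rintro rfl; omega
              omega
            nlinarith
          rw [this, mul_one]
        rw [this, hk, Nat.add_sub_cancel_left, hV1])
  have hchar : ∀ n ≤ 0, (c n : ℂ) = (vacuumCharacter k).coeff n := by
    intro n hn
    rw [hc n hn, coeff_vacuumCharacter, ← hV, laurentCoeff_castSeries]
    simp only [laurentCoeff]
    by_cases h : -(k : ℤ) ≤ n
    · rw [if_pos h, if_pos (by omega), show k - n.natAbs = (n + k).toNat by omega]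
    · rw [if_neg h, if_neg (by omega)]
  have huniq : ∀ (Z : ℍ → ℂ), IsExtremalPartitionFunction k Z → Z = f := by
    rintro Z ⟨hZ, w, hw, hwv⟩
    have h1 := (isWeakForm_zero_iff.mpr ⟨hZ, hw⟩).add (hf.smul (-1))
    have h2 := h1.eq_zero_of_coeff_nonpos fun n hn => by
      simp [hwv n hn, hchar n hn]
    have h3 : Z - f = 0 := by
      rw [← h2]
      ext τ
      simp [sub_eq_add_neg]
    exact sub_eq_zero.mp h3
  refine ⟨⟨f, ⟨(isWeakForm_zero_iff.mp hf).1, _, hf.expansion, hchar⟩, huniq⟩, ?_⟩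
  intro Z w hZ hw
  rw [huniq Z hZ] at hw
  exact ⟨c, fun n => congrFun (hw.unique hf.expansion) n, hcM⟩

/-! ### Initial coefficients of `qj` modulo `2¹¹ 3⁵ 5²` -/

/-- Coefficientwise sum of lists modulo `M`. -/
def addList (M : ℕ) : List ℕ → List ℕ → List ℕ
  | [], l => l
  | a :: k, [] => a :: k
  | a :: k, b :: l => (a + b) % M :: addList M k l

/-- Convolution of lists modulo `M`. -/
def mulList (M : ℕ) : List ℕ → List ℕ → List ℕ
  | [], _ => []
  | a :: k, l => addList M (l.map fun b => a * b % M) (0 :: mulList M k l)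

/-- The power series with the given list of initial coefficients. -/
def listSeries (M : ℕ) (l : List ℕ) : (ZMod M)⟦X⟧ := PowerSeries.mk fun n => (l.getD n 0 : ZMod M)

lemma listSeries_nil (M : ℕ) : listSeries M [] = 0 := by
  ext n
  simp [listSeries]

lemma listSeries_cons (M a : ℕ) (l : List ℕ) :
    listSeries M (a :: l) = PowerSeries.C (a : ZMod M) + PowerSeries.X * listSeries M l := by
  ext n
  cases n with
  | zero => simp [listSeries]
  | succ n =>
    rw [map_add, PowerSeries.coeff_succ_X_mul, PowerSeries.coeff_C]
    simp [listSeries]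

lemma listSeries_addList (M : ℕ) (k l : List ℕ) :
    listSeries M (addList M k l) = listSeries M k + listSeries M l := by
  induction k generalizing l with
  | nil => simp [addList, listSeries_nil]
  | cons a k ih =>
    cases l with
    | nil => simp [addList, listSeries_nil]
    | cons b l =>
      rw [addList, listSeries_cons, listSeries_cons, listSeries_cons, ih, ZMod.natCast_mod,
        Nat.cast_add, map_add]
      ring

lemma listSeries_map_mul (M a : ℕ) (l : List ℕ) :
    listSeries M (l.map fun b => a * b % M) = PowerSeries.C (a : ZMod M) * listSeries M l := by
  induction l with
  | nil => simp [listSeries_nil]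
  | cons b l ih =>
    rw [List.map_cons, listSeries_cons, listSeries_cons, ih, ZMod.natCast_mod, Nat.cast_mul, map_mul]
    ring

lemma listSeries_mulList (M : ℕ) (k l : List ℕ) :
    listSeries M (mulList M k l) = listSeries M k * listSeries M l := by
  induction k with
  | nil => simp [mulList, listSeries_nil]
  | cons a k ih =>
    rw [mulList, listSeries_addList, listSeries_map_mul, listSeries_cons, listSeries_cons, ih,
      Nat.cast_zero, map_zero]
    ring

/-- The first `L` coefficients of `P` are given by `l`. -/
def HasInitialCoeffs (M L : ℕ) (l : List ℕ) (P : (ZMod M)⟦X⟧) : Prop :=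
  ∀ n < L, PowerSeries.coeff n P = (l.getD n 0 : ZMod M)

lemma HasInitialCoeffs.mul {M L : ℕ} {k l m : List ℕ} {P Q : (ZMod M)⟦X⟧}
    (hP : HasInitialCoeffs M L k P) (hQ : HasInitialCoeffs M L l Q)
    (h : (mulList M k l).take L = m) : HasInitialCoeffs M L m (P * Q) := by
  intro n hn
  have h1 : PowerSeries.coeff n (P * Q) = PowerSeries.coeff n (listSeries M k * listSeries M l) := by
    rw [PowerSeries.coeff_mul, PowerSeries.coeff_mul]
    refine Finset.sum_congr rfl fun x hx => ?_
    have := Finset.HasAntidiagonal.mem_antidiagonal.mp hx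
    rw [hP _ (by omega), hQ _ (by omega)]
    simp [listSeries]
  rw [h1, ← listSeries_mulList, listSeries, PowerSeries.coeff_mk, ← h]
  simp [List.getD_eq_getElem?_getD, List.getElem?_take_of_lt hn]

/-- A kernel-friendly divisor sum. -/
def divisorSum (k n : ℕ) : ℕ :=
  ((List.range (n + 1)).map fun d => if n % d = 0 then d ^ k else 0).sum

/-- The range includes `d = 0`. Since `n % 0 = n`, it contributes only for `n = 0`, and then `0 ^ k
= 0` because `k ≠ 0`. -/
lemma sigma_eq_divisorSum (k n : ℕ) (hk : k ≠ 0) :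
    ArithmeticFunction.sigma k n = divisorSum k n := by
  have h1 : divisorSum k n = ∑ d ∈ Finset.range (n + 1), if n % d = 0 then d ^ k else 0 := rfl
  rw [h1, ArithmeticFunction.sigma_apply, ← Finset.sum_filter]
  refine Finset.sum_subset (fun d hd => ?_) (fun d hd hd' => ?_)
  · have hdn := Nat.dvd_of_mem_divisors hd
    have := Nat.divisor_le hd
    simp only [Finset.mem_filter, Finset.mem_range]
    exact ⟨by omega, Nat.mod_eq_zero_of_dvd hdn⟩
  · have hdn := Nat.dvd_of_mod_eq_zero (Finset.mem_filter.mp hd).2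
    have hn : n = 0 := by
      by_contra hn
      exact hd' (Nat.mem_divisors.mpr ⟨hdn, hn⟩)
    have : d = 0 := by
      have := Finset.mem_range.mp (Finset.mem_filter.mp hd).1
      omega
    rw [this, zero_pow hk]

/-- The common modulus `2¹¹ 3⁵ 5²`. -/
def kleinModulus : ℕ := 12441600

/-- Residues of `σ₃(n)`. -/
def sigmaThreeList : List ℕ :=
  [0, 1, 9, 28, 73, 126, 252, 344, 585, 757, 1134, 1332, 2044, 2198, 3096, 3528, 4681, 4914, 6813,
   6860, 9198, 9632, 11988, 12168, 16380, 15751, 19782, 20440, 25112, 24390, 31752, 29792, 37449,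
   37296, 44226, 43344, 55261, 50654, 61740, 61544, 73710, 68922, 86688, 79508, 97236, 95382,
   109512, 103824, 131068, 117993, 141759, 137592, 160454, 148878, 183960, 167832, 201240, 192080,
   219510, 205380, 257544, 226982, 268128, 260408, 299593, 276948, 335664, 300764, 358722, 340704,
   390096, 357912, 442845, 389018, 455886, 441028, 500780, 458208, 553896, 493040, 589806, 551881,
   620298, 571788, 703136, 619164, 715572]

/-- Residues of `σ₅(n)`. -/
def sigmaFiveList : List ℕ :=
  [0, 1, 33, 244, 1057, 3126, 8052, 16808, 33825, 59293, 103158, 161052, 257908, 371294, 554664,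
   762744, 1082401, 1419858, 1956669, 2476100, 3304182, 4101152, 5314716, 6436344, 8253300, 9768751,
   12252702, 1966600, 5324456, 8069550, 287352, 3745952, 9753633, 1971888, 9530514, 2775408, 464701,
   7135958, 7061700, 3504536, 6204150, 3881802, 10922016, 10150844, 8491164, 11167518, 892152,
   5396208, 2832244, 8776857, 11328783, 10522152, 6768158, 7622694, 2689800, 5784552, 8658600,
   6971600, 5021550, 5753100, 9958008, 11009102, 11642016, 1268744, 1076257, 3596244, 2864304,
   6432308, 7797906, 2826336, 4497264, 197352, 2488125, 7765994, 11537814, 7229644, 4501700,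
   7134816, 3675288, 3981200, 11911926, 5103001, 3683466, 7495044, 5240864, 9266508, 11496252]

/-- Residues of the coefficients of `(∑ σ₃(n) Xⁿ)²`. -/
def sigmaThreeSqList : List ℕ :=
  [0, 0, 1, 18, 137, 650, 2350, 6860, 17609, 39870, 83976, 162382, 301070, 522886, 885284, 1424468,
   2254537, 3419448, 5143987, 7448874, 10750712, 2574272, 8507010, 3490244, 1214222, 1096750,
   5246492, 118116, 1351908, 6891166, 9577500, 5322736, 2428617, 6950992, 5657706, 1179160,
   11513819, 7277754, 2908406, 11928532, 7524984, 5543708, 8609120, 783230, 6652450, 4975670,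
   2356044, 4156072, 6137614, 3378420, 4638901, 4439076, 247244, 10160658, 2815804, 9131532,
   11335396, 12205392, 5631204, 11055062, 8099420, 12395342, 2374736, 6509900, 12302025, 6647536,
   920064, 5473138, 6037242, 10172096, 2855784, 10879404, 5755163, 6252684, 5760920, 11185318,
   6538582, 3100928, 8525372, 8711576, 5269112, 9855612, 6036054, 7673482, 9767520, 4953348,
   1583378]

/-- Residues of the coefficients of `(∑ σ₃(n) Xⁿ)³`. -/
def sigmaThreeCubeList : List ℕ :=
  [0, 0, 0, 1, 27, 327, 2460, 13476, 58731, 214741, 685182, 1954953, 5095048, 12285903, 2895366,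
   9545040, 8721579, 11079792, 5515914, 2654073, 11819808, 1157516, 3350670, 3148068, 3417096,
   4280787, 4620480, 7771150, 3849246, 11998503, 8782014, 4910592, 12340395, 6577770, 4638852,
   9379668, 11070697, 8866935, 4808088, 5181212, 5476416, 3622188, 7817292, 10857657, 2620434,
   7162155, 570522, 6460272, 8332552, 2292900, 3835392, 7516890, 7227258, 10333791, 7544964,
   4350252, 513054, 2154422, 4383996, 7990977, 653190, 11160183, 4835112, 3472136, 6220971, 1192662,
   8495826, 2799777, 2548458, 10838628, 7670328, 3041892, 3542457, 7944588, 8743158, 7327285,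
   1576116, 10509924, 4959786, 10679088, 11990976, 9808462, 11305974, 119961, 9537068, 11034054,
   9727302]

/-- Residues of the coefficients of `(∑ σ₅(n) Xⁿ)²`. -/
def sigmaFiveSqList : List ℕ :=
  [0, 0, 1, 66, 1577, 18218, 135550, 738236, 3207785, 11714718, 22344, 6966670, 3774686, 9576886,
   6926804, 6422852, 855145, 3085656, 2113651, 60090, 6628856, 3597920, 7714722, 9231956, 11311070,
   9046558, 6907820, 1303140, 2437524, 8388910, 2063436, 9555760, 10484841, 10953472, 3313674,
   5806744, 6224315, 11499546, 202790, 6886756, 10241400, 1549580, 10575872, 5170046, 2002114,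
   9572294, 9370140, 689416, 9021406, 350532, 1810309, 3486660, 7379996, 10006866, 4233340,
   11823036, 12218260, 12254880, 3269460, 10130870, 9218444, 1197470, 1223312, 4461596, 1354857,
   3218752, 1349040, 6934306, 5967834, 7284896, 279912, 2285340, 1503995, 10682556, 5671064,
   11817382, 5764870, 11194592, 7535372, 6376760, 9736568, 1390620, 7358982, 790426, 4395264,
   9890244, 6674930]

/-- Residues of the coefficients of `Δ`. -/
def discriminantList : List ℕ :=
  [0, 1, 12441576, 252, 12440128, 4830, 12435552, 12424856, 84480, 12327957, 12325680, 534612,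
   12070656, 11863862, 401856, 1217160, 987136, 5535666, 2727432, 10661420, 5331840, 8222112,
   12052512, 6201672, 8847360, 11825575, 1424112, 1370520, 12205568, 3990630, 8112960, 9364832,
   2359296, 10306224, 4001616, 6217680, 5541696, 4410686, 5399520, 3709224, 9907200, 9522042,
   1734912, 7757492, 9313536, 10976310, 459072, 12404496, 12367872, 7533993, 2343000, 1528632,
   4401536, 8910702, 4432320, 6764760, 3809280, 11733840, 3757680, 11385060, 12372480, 1624262,
   11634432, 11715192, 11911168, 8885460, 1482624, 7965116, 747648, 7621344, 74880, 12387672,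
   4354560, 8124122, 6117936, 6502500, 7688960, 6408672, 10511424, 8224880, 2734080, 10455561,
   7861392, 2193132, 2727936, 268380, 444192]

/-- Residues of the coefficients of `q j`. -/
def kleinList : List ℕ :=
  [1, 744, 196884, 9052160, 5829570, 3373056, 4151000, 6967296, 10827135, 6758400, 5477220, 0,
   8242494, 7464960, 10161720, 2781184, 9094275, 552960, 5529960, 2488320, 11808450, 3481600,
   1524096, 2488320, 3485820, 4478976, 10413900, 7481344, 10424700, 4423680, 7619576, 0, 5449221,
   143360, 10808640, 2985984, 10689800, 2985984, 5871960, 4454400, 8314488, 0, 4243720, 2488320,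
   12393270, 2140160, 4908600, 6967296, 10068235, 2488320, 4177332, 6604800, 12022668, 6082560,
   3140120, 8957952, 4295025, 8163328, 388800, 0, 5488174, 0, 4443768, 10680320, 6194070, 6193152,
   2381200, 4976640, 11675610, 5242880, 9051264, 0, 11426147, 0, 2547720, 3596288, 8517150, 9732096,
   6920320, 4976640, 5943078, 1536000, 6499764, 2488320, 4532970, 10948608]


lemma hasInitialCoeffs_sigmaSeries {k : ℕ} (hk : k ≠ 0) {M L : ℕ} {l : List ℕ}
    (h : ∀ n < L, divisorSum k n % M = l.getD n 0) :
    HasInitialCoeffs M L l (castSeries (ZMod M) (sigmaSeries k)) := by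
  intro n hn
  rw [← h n hn, ZMod.natCast_mod, ← sigma_eq_divisorSum k n hk]
  simp [sigmaSeries]

lemma hasInitialCoeffs_sigmaThree : HasInitialCoeffs kleinModulus 87 sigmaThreeList
    (castSeries (ZMod kleinModulus) (sigmaSeries 3)) :=
  hasInitialCoeffs_sigmaSeries (by norm_num) (by decide +kernel)

lemma hasInitialCoeffs_sigmaFive : HasInitialCoeffs kleinModulus 87 sigmaFiveList
    (castSeries (ZMod kleinModulus) (sigmaSeries 5)) :=
  hasInitialCoeffs_sigmaSeries (by norm_num) (by decide +kernel)

lemma mulList_sigmaThree_sq : (mulList kleinModulus sigmaThreeList sigmaThreeList).take 87 =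
    sigmaThreeSqList := by decide +kernel

lemma mulList_sigmaThree_cube : (mulList kleinModulus sigmaThreeSqList sigmaThreeList).take 87 =
    sigmaThreeCubeList := by decide +kernel

lemma mulList_sigmaFive_sq : (mulList kleinModulus sigmaFiveList sigmaFiveList).take 87 =
    sigmaFiveSqList := by decide +kernel

/-- The negative term `-147 (∑ σ₅(n) Xⁿ)²` is moved to the left so that the check stays in `ℕ`. -/
lemma check_discriminantList : ∀ n < 87,
    (discriminantList.getD n 0 + 147 * sigmaFiveSqList.getD n 0) % kleinModulus =
      ((5 * divisorSum 3 n + 7 * divisorSum 5 n) / 12 + 100 * sigmaThreeSqList.getD n 0 +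
        8000 * sigmaThreeCubeList.getD n 0) % kleinModulus := by decide +kernel

/-- Residues of the coefficients of `E₄³`. -/
def eisensteinCube (n : ℕ) : ℕ :=
  (if n = 0 then 1 else 0) + 720 * sigmaThreeList.getD n 0 + 172800 * sigmaThreeSqList.getD n 0 +
    13824000 * sigmaThreeCubeList.getD n 0

/-- No division is performed: the table for `qj` is certified through `Δ · (qj) = q E₄³`. -/
lemma check_kleinList : (mulList kleinModulus discriminantList kleinList).take 87 =
    0 :: (List.range 86).map fun n => eisensteinCube n % kleinModulus := by decide +kernel

lemma coeff_discriminantLinear (n : ℕ) : PowerSeries.coeff n discriminantLinear =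
    (((5 * divisorSum 3 n + 7 * divisorSum 5 n) / 12 : ℕ) : ℤ) := by
  rw [discriminantLinear, PowerSeries.coeff_mk, sigma_eq_divisorSum 3 n (by norm_num),
    sigma_eq_divisorSum 5 n (by norm_num)]
  push_cast
  rfl

lemma hasInitialCoeffs_sigmaThree_sq : HasInitialCoeffs kleinModulus 87 sigmaThreeSqList
    (castSeries (ZMod kleinModulus) (sigmaSeries 3) ^ 2) := by
  rw [sq]
  exact hasInitialCoeffs_sigmaThree.mul hasInitialCoeffs_sigmaThree mulList_sigmaThree_sq

lemma hasInitialCoeffs_sigmaThree_cube : HasInitialCoeffs kleinModulus 87 sigmaThreeCubeList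
    (castSeries (ZMod kleinModulus) (sigmaSeries 3) ^ 3) := by
  rw [pow_succ]
  exact hasInitialCoeffs_sigmaThree_sq.mul hasInitialCoeffs_sigmaThree mulList_sigmaThree_cube

lemma hasInitialCoeffs_sigmaFive_sq : HasInitialCoeffs kleinModulus 87 sigmaFiveSqList
    (castSeries (ZMod kleinModulus) (sigmaSeries 5) ^ 2) := by
  rw [sq]
  exact hasInitialCoeffs_sigmaFive.mul hasInitialCoeffs_sigmaFive mulList_sigmaFive_sq

lemma hasInitialCoeffs_discriminant : HasInitialCoeffs kleinModulus 87 discriminantList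
    (castSeries (ZMod kleinModulus) discriminantSeries) := by
  intro n hn
  have h := (ZMod.natCast_eq_natCast_iff' _ _ kleinModulus).mpr (check_discriminantList n hn)
  have hs : discriminantSeries = discriminantLinear + PowerSeries.C 100 * sigmaSeries 3 ^ 2 +
      PowerSeries.C 8000 * sigmaSeries 3 ^ 3 - PowerSeries.C 147 * sigmaSeries 5 ^ 2 := rfl
  simp only [hs, map_sub, map_add, map_mul, map_pow, PowerSeries.map_C, PowerSeries.coeff_C_mul,
    hasInitialCoeffs_sigmaThree_sq n hn, hasInitialCoeffs_sigmaThree_cube n hn,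
    hasInitialCoeffs_sigmaFive_sq n hn]
  rw [PowerSeries.coeff_map, coeff_discriminantLinear]
  simp only [eq_intCast, Int.cast_natCast, Int.cast_ofNat]
  push_cast at h
  linear_combination -h

lemma coeff_eisensteinFour_cube (n : ℕ) (hn : n < 87) :
    PowerSeries.coeff n (castSeries (ZMod kleinModulus) (eisensteinFour ^ 3)) =
      (eisensteinCube n : ZMod kleinModulus) := by
  have h : eisensteinFour ^ 3 = 1 + PowerSeries.C 720 * sigmaSeries 3 +
      PowerSeries.C 172800 * sigmaSeries 3 ^ 2 + PowerSeries.C 13824000 * sigmaSeries 3 ^ 3 := by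
    rw [eisensteinFour]
    simp only [map_ofNat]
    ring
  rw [h]
  simp only [map_add, map_mul, map_pow, map_one, PowerSeries.map_C, PowerSeries.coeff_C_mul,
    hasInitialCoeffs_sigmaThree n hn,
    hasInitialCoeffs_sigmaThree_sq n hn, hasInitialCoeffs_sigmaThree_cube n hn, eisensteinCube,
    PowerSeries.coeff_one]
  simp only [eq_intCast, Int.cast_ofNat]
  push_cast
  rfl

lemma discriminantSeries_mul_kleinSeries :
    discriminantSeries * kleinSeries = PowerSeries.X * eisensteinFour ^ 3 := by
  rw [kleinSeries, ← X_mul_discriminantUnit]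
  linear_combination (PowerSeries.X * eisensteinFour ^ 3) * discriminantUnit_mul_inv

lemma hasInitialCoeffs_klein : HasInitialCoeffs kleinModulus 86 kleinList
    (castSeries (ZMod kleinModulus) kleinSeries) := by
  set φ := castSeries (ZMod kleinModulus)
  have h1 := hasInitialCoeffs_discriminant.mul (Q := listSeries kleinModulus kleinList)
    (l := kleinList) (fun n _ => by simp [listSeries]) check_kleinList
  -- The table and the true series have the same product with `Δ` up to `X^86`. Since `Δ` is `X`
  -- times a unit, cancelling it costs one coefficient: 87 become 86.
  have h2 : PowerSeries.X ^ 87 ∣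
      φ discriminantSeries * (φ kleinSeries - listSeries kleinModulus kleinList) := by
    rw [PowerSeries.X_pow_dvd_iff]
    intro n hn
    rw [mul_sub, map_sub, h1 n hn, ← map_mul, discriminantSeries_mul_kleinSeries, map_mul,
      PowerSeries.map_X, sub_eq_zero]
    cases n with
    | zero => simp
    | succ n =>
      rw [PowerSeries.coeff_succ_X_mul, coeff_eisensteinFour_cube n (by omega), List.getD_cons_succ,
        List.getD_eq_getElem?_getD, List.getElem?_map, List.getElem?_range (by omega)]
      simp
  rw [← X_mul_discriminantUnit, map_mul, PowerSeries.map_X, pow_succ', mul_assoc] at h2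
  have h3 : PowerSeries.X ^ 86 ∣
      φ discriminantUnit * (φ kleinSeries - listSeries kleinModulus kleinList) := by
    obtain ⟨T, hT⟩ := h2
    exact ⟨T, PowerSeries.X_mul_cancel (by rw [hT, mul_assoc])⟩
  have h4 := h3.mul_left (φ discriminantInv)
  rw [← mul_assoc, ← map_mul, mul_comm discriminantInv, discriminantUnit_mul_inv, map_one, one_mul,
    PowerSeries.X_pow_dvd_iff] at h4
  intro n hn
  have := h4 n hn
  rw [map_sub, sub_eq_zero] at this
  rw [this]
  simp [listSeries]

lemma dvd_coeff_kleinSeries_of_list {M : ℕ} (hM : M ∣ kleinModulus) {n : ℕ} (hn : n < 86)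
    (h : M ∣ kleinList.getD n 0) : (M : ℤ) ∣ PowerSeries.coeff n kleinSeries := by
  have h1 := hasInitialCoeffs_klein n hn
  rw [PowerSeries.coeff_map, eq_intCast, ← Int.cast_natCast, ZMod.intCast_eq_intCast_iff_dvd_sub] at h1
  have h2 : (M : ℤ) ∣ ((kleinList.getD n 0 : ℕ) : ℤ) - PowerSeries.coeff n kleinSeries :=
    (Int.natCast_dvd_natCast.mpr hM).trans h1
  exact (dvd_sub_right (Int.natCast_dvd_natCast.mpr h)).mp h2

/-! ### Eisenstein series congruent to `1`, prime by prime -/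

/-- Each squaring gains a factor 2. As `240 = 16 · 15`, this gives `E₄^128 ≡ 1 (mod 2¹¹)` at `k =
7`. -/
lemma exists_one_add_mul_pow_two {R : Type*} [CommRing R] (x : R) (k : ℕ) :
    ∃ y, (1 + 16 * x) ^ 2 ^ k = 1 + 2 ^ (k + 4) * y := by
  induction k with
  | zero => exact ⟨x, by norm_num⟩
  | succ k ih =>
    obtain ⟨y, hy⟩ := ih
    refine ⟨y + 2 ^ (k + 3) * y ^ 2, ?_⟩
    rw [pow_succ, pow_mul, hy]
    ring

/-- Each cubing gains a factor 3. As `504 = 9 · 56`, this gives `E₆^27 ≡ 1 (mod 3⁵)` at `k = 3`. -/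
lemma exists_one_add_mul_pow_three {R : Type*} [CommRing R] (x : R) (k : ℕ) :
    ∃ y, (1 + 9 * x) ^ 3 ^ k = 1 + 3 ^ (k + 2) * y := by
  induction k with
  | zero => exact ⟨x, by norm_num⟩
  | succ k ih =>
    obtain ⟨y, hy⟩ := ih
    refine ⟨y + 3 ^ (k + 2) * y ^ 2 + 3 ^ (2 * k + 3) * y ^ 3, ?_⟩
    rw [pow_succ, pow_mul, hy]
    ring

lemma castSeries_eq_one_of_eq {M : ℕ} {ε y : ℤ⟦X⟧} (h : ε = 1 + (M : ℤ⟦X⟧) * y) :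
    castSeries (ZMod M) ε = 1 := by
  have h1 : ((M : ℕ) : (ZMod M)⟦X⟧) = 0 := by
    rw [← map_natCast (PowerSeries.C (R := ZMod M)) M, ZMod.natCast_self, map_zero]
  rw [h, map_add, map_mul, map_one, map_natCast, h1, zero_mul, add_zero]

lemma exists_eisenstein_monomial_of_eq {w : ℕ} (a b : ℕ) (h : w = 4 * a + 6 * b) :
    ∃ e : ModularForm 𝒮ℒ w,
      qExpansion 1 e = castSeries ℂ (eisensteinFour ^ a * eisensteinSix ^ b) := by
  obtain ⟨e, he⟩ := exists_eisenstein_monomial a b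
  exact ⟨ModularForm.mcast (by rw [h]; push_cast; ring) e, he⟩

lemma dvd_coeff_kleinJ_two (n : ℤ) (hn : n ≠ 0) :
    (2 ^ 11 : ℤ) ∣ laurentCoeff 1 kleinSeries ((2 : ℕ) * n) := by
  have : Fact (Nat.Prime 2) := ⟨by norm_num⟩
  obtain ⟨e, he⟩ := exists_eisenstein_monomial_of_eq (w := 512) 128 0 (by norm_num)
  obtain ⟨y, hy⟩ := exists_one_add_mul_pow_two (15 * sigmaSeries 3) 7
  -- Weight 512 gives the bound `512 / 12 = 42`. The coefficient of `q^{2n}` in `j` has index `2n +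
  -- 1` in `qj`, at most 85, which fixes the table length 86.
  have hlist : ∀ n < 43, 1 ≤ n → 2048 ∣ kleinList.getD (2 * n + 1) 0 := by decide +kernel
  have := dvd_coeff_kleinJ 2 2048 512 (by norm_num) (pow_dvd_pow 2 (by norm_num : 11 ≤ 511)) e _ he
    (castSeries_eq_one_of_eq (y := y) (by
      have h1 : eisensteinFour = 1 + 16 * (15 * sigmaSeries 3) := by
        rw [eisensteinFour]
        ring
      rw [pow_zero, mul_one, h1, show 128 = 2 ^ 7 by norm_num, hy]
      norm_num))
    (fun m h1 h2 => dvd_coeff_kleinSeries_of_list (by decide +kernel) (by omega)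
      (hlist m (by omega) h1)) n hn
  exact_mod_cast this

lemma dvd_coeff_kleinJ_three (n : ℤ) (hn : n ≠ 0) :
    (3 ^ 5 : ℤ) ∣ laurentCoeff 1 kleinSeries ((3 : ℕ) * n) := by
  have : Fact (Nat.Prime 3) := ⟨by norm_num⟩
  obtain ⟨e, he⟩ := exists_eisenstein_monomial_of_eq (w := 162) 0 27 (by norm_num)
  obtain ⟨y, hy⟩ := exists_one_add_mul_pow_three (-56 * sigmaSeries 5) 3
  have hlist : ∀ n < 14, 1 ≤ n → 243 ∣ kleinList.getD (3 * n + 1) 0 := by decide +kernel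
  have := dvd_coeff_kleinJ 3 243 162 (by norm_num) (pow_dvd_pow 3 (by norm_num : 5 ≤ 161)) e _ he
    (castSeries_eq_one_of_eq (y := y) (by
      have h1 : eisensteinSix = 1 + 9 * (-56 * sigmaSeries 5) := by
        rw [eisensteinSix]
        ring
      rw [pow_zero, one_mul, h1, show 27 = 3 ^ 3 by norm_num, hy]
      norm_num))
    (fun m h1 h2 => dvd_coeff_kleinSeries_of_list (by decide +kernel) (by omega)
      (hlist m (by omega) h1)) n hn
  exact_mod_cast this

lemma dvd_coeff_kleinJ_five (n : ℤ) (hn : n ≠ 0) :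
    (5 ^ 2 : ℤ) ∣ laurentCoeff 1 kleinSeries ((5 : ℕ) * n) := by
  have : Fact (Nat.Prime 5) := ⟨by norm_num⟩
  obtain ⟨e, he⟩ := exists_eisenstein_monomial_of_eq (w := 20) 5 0 (by norm_num)
  have hlist : ∀ n < 2, 1 ≤ n → 25 ∣ kleinList.getD (5 * n + 1) 0 := by decide +kernel
  have := dvd_coeff_kleinJ 5 25 20 (by norm_num) (pow_dvd_pow 5 (by norm_num : 2 ≤ 19)) e _ he
    -- The binomial expansion of `(1 + 5 · 48 σ)⁵`, with `1` removed and divided by 25.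
    (castSeries_eq_one_of_eq (y := 48 * sigmaSeries 3 + 2 * 48 ^ 2 * 5 * sigmaSeries 3 ^ 2 +
        2 * 48 ^ 3 * 25 * sigmaSeries 3 ^ 3 + 48 ^ 4 * 125 * sigmaSeries 3 ^ 4 +
        48 ^ 5 * 125 * sigmaSeries 3 ^ 5) (by
      rw [pow_zero, mul_one, eisensteinFour]
      push_cast
      ring))
    (fun m h1 h2 => dvd_coeff_kleinSeries_of_list (by decide +kernel) (by omega)
      (hlist m (by omega) h1)) n hn
  exact_mod_cast this

lemma dvd_coeff_kleinJ_seven (n : ℤ) (hn : n ≠ 0) :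
    (7 : ℤ) ∣ laurentCoeff 1 kleinSeries ((7 : ℕ) * n) := by
  have : Fact (Nat.Prime 7) := ⟨by norm_num⟩
  exact dvd_coeff_kleinJ 7 7 6 (by norm_num) (dvd_pow_self 7 (by norm_num)) E₆ _ qExpansion_E₆
    (castSeries_eq_one_of_eq (y := -72 * sigmaSeries 5) (by
      rw [eisensteinSix]
      push_cast
      ring))
    (fun m h1 h2 => by omega) n hn

lemma dvd_coeff_kleinJ_eleven (n : ℤ) (hn : n ≠ 0) :
    (11 : ℤ) ∣ laurentCoeff 1 kleinSeries ((11 : ℕ) * n) := by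
  have : Fact (Nat.Prime 11) := ⟨by norm_num⟩
  -- `E₁₀ ≡ 1 (mod 11)` since `264 = 11 · 24`; its weight is below 12, so no coefficient has to be
  -- checked.
  have hq := qExpansion_E_of_coeff (k := 10) (by norm_num) ⟨5, rfl⟩ (-264)
    (by norm_num [show bernoulli 10 = 5 / 66 by decide +kernel])
  exact dvd_coeff_kleinJ 11 11 10 (by norm_num) (dvd_pow_self 11 (by norm_num)) (E (by norm_num)) _ hq
    (castSeries_eq_one_of_eq (y := -24 * sigmaSeries 9) (by
      push_cast
      ring))
    (fun m h1 h2 => by omega) n hn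

end ExtremalCFT

end

theorem theorem3 (p k : ℕ) (hp : p.Prime) (hp11 : p ≤ 11)
    (hk : (1 ≤ k ∧ k ≤ p - 1) ∨ k = p + 1) :
    (∃! Z : ℍ → ℂ, ExtremalCFT.IsExtremalPartitionFunction k Z) ∧
    ∀ (Z : ℍ → ℂ) (w : ℤ → ℂ), ExtremalCFT.IsExtremalPartitionFunction k Z →
      ExtremalCFT.HasLaurentQExpansion Z w →
      ∃ c : ℤ → ℤ, (∀ n : ℤ, w n = (c n : ℂ)) ∧
        ∀ n : ℤ, n ≠ 0 →
          (p = 2 → c ((p : ℤ) * n) ≡ 0 [ZMOD 2 ^ 11]) ∧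
          (p = 3 → c ((p : ℤ) * n) ≡ 0 [ZMOD 3 ^ 5]) ∧
          (p = 5 → c ((p : ℤ) * n) ≡ 0 [ZMOD 5 ^ 2]) ∧
          (p = 7 ∨ p = 11 → c ((p : ℤ) * n) ≡ 0 [ZMOD (p : ℤ)]) := by
  have : Fact p.Prime := ⟨hp⟩
  obtain ⟨M, hj, hM⟩ : ∃ M : ℤ,
      (∀ n : ℤ, n ≠ 0 → M ∣ ExtremalCFT.laurentCoeff 1 ExtremalCFT.kleinSeries (p * n)) ∧
      (p = 2 → M = 2 ^ 11) ∧ (p = 3 → M = 3 ^ 5) ∧ (p = 5 → M = 5 ^ 2) ∧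
      (p = 7 ∨ p = 11 → M = p) := by
    have hcases : p = 2 ∨ p = 3 ∨ p = 5 ∨ p = 7 ∨ p = 11 := by
      interval_cases p <;> revert hp <;> decide
    rcases hcases with rfl | rfl | rfl | rfl | rfl
    · exact ⟨2 ^ 11, ExtremalCFT.dvd_coeff_kleinJ_two, by norm_num⟩
    · exact ⟨3 ^ 5, ExtremalCFT.dvd_coeff_kleinJ_three, by norm_num⟩
    · exact ⟨5 ^ 2, ExtremalCFT.dvd_coeff_kleinJ_five, by norm_num⟩
    · exact ⟨7, ExtremalCFT.dvd_coeff_kleinJ_seven, by norm_num⟩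
    · exact ⟨11, ExtremalCFT.dvd_coeff_kleinJ_eleven, by norm_num⟩
  obtain ⟨h1, h2⟩ := ExtremalCFT.extremalPartitionFunction_of_dvd_coeff_kleinJ hj hk
  refine ⟨h1, fun Z w hZ hw => ?_⟩
  obtain ⟨c, hc, hcM⟩ := h2 Z w hZ hw
  refine ⟨c, hc, fun n hn => ?_⟩
  have h := Int.modEq_zero_iff_dvd.mpr (hcM n hn)
  exact ⟨fun hp => hM.1 hp ▸ h, fun hp => hM.2.1 hp ▸ h, fun hp => hM.2.2.1 hp ▸ h,
    fun hp => hM.2.2.2 hp ▸ h⟩
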